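/- Let $(Y_t)_{t\ge 0}$ be a real-valued stationary Gaussian process on a probability space whose sample paths are almost surely differentiable, with derivative process $\dot Y$, such that $E[Y_t]=0$ and $\mathrm{var}(Y_t)=\mathrm{var}(\dot Y_t)=1$ for all $t$, and which is ergodic: for every bounded measurable functional $g$ of the path, almost surely $\lim_{H\to\infty}\frac1H\int_0^H g(Y_{\cdot+s})\,ds=E[g(Y_\cdot)]$. Let $f:\mathbb R^2\to(0,\infty)$ be measurable with $$q_0:=E\left[\frac1{f(U)}\right]<\infty,$$ where $U$ is a standard normal vector in $\mathbb R^2$. Assume that, almost surely, for all $t\ge 0$, $$Z_t=Y_{\varphi(t)},\qquad \varphi(t)=\int_0^t f\big(Y_{\varphi(s)},\dot Y_{\varphi(s)}\big)\,ds<\infty,\qquad h(X_t)=Z_t,$$ where $h:D\to\mathbb R$ is a strictly increasing function on a set $D\subseteq\mathbb R$ (for instance $D=\mathbb R$) and the process $X$ takes its values in $D$. A path $x:[0,\infty)\to\mathbb R$ has an up-crossing of the level $v$ at $t>0$ if $x(t)=v$, $x\le v$ on some interval $(t-\varepsilon,t)$ and $x\ge v$ on some interval $(t,t+\varepsilon)$,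 with $\varepsilon>0$. Let $\nu_T^+(x,v)$ be the number of up-crossings of $v$ by $x$ on $[0,T]$, and let $\nu^+(x,v):=\lim_{T\to\infty}\frac1T\nu_T^+(x,v)$ be the up-crossing intensity. Then, for every $u\in D$, almost surely the numbers of up-crossings on bounded intervals of the level $u$ by $X$, and of the level $h(u)$ by $Z$ and by $Y$, are finite, the three intensities below exist and are deterministic constants, and $$\nu^+(X,u)=\nu^+(Z,h(u))=\frac1{q_0}\,\nu^+(Y,h(u))=\frac1{2\pi q_0}\exp\left(-\frac{h(u)^2}{2}\right).$$ -/

import Mathlib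

open MeasureTheory ProbabilityTheory Filter Topology
open scoped NNReal

noncomputable section

namespace TimeChange

variable {Ω : Type*} [MeasurableSpace Ω]

/-- The process `(Y_t)_{t ≥ 0}` is (strictly) stationary: its law on path space, equipped with the
product σ-algebra, is invariant under time shifts. -/
def IsStationary (Y : ℝ≥0 → Ω → ℝ) (P : Measure Ω) : Prop :=
  ∀ s : ℝ≥0, P.map (fun ω t => Y (t + s) ω) = P.map (fun ω t => Y t ω)

/-- Ergodicity: for every bounded measurable functional `g` of the path, almost surely
`(1/H) ∫₀ᴴ g(Y_{·+s}) ds → E[g(Y_·)]` as `H → ∞`. -/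
def IsErgodic (Y : ℝ≥0 → Ω → ℝ) (P : Measure Ω) : Prop :=
  ∀ g : (ℝ≥0 → ℝ) → ℝ, Measurable g → (∃ C : ℝ, ∀ y, |g y| ≤ C) →
    ∀ᵐ ω ∂P, Tendsto
      (fun H : ℝ => H⁻¹ * ∫ s in (0 : ℝ)..H, g (fun t => Y (t + s.toNNReal) ω))
      atTop (𝓝 (∫ ω', g (fun t => Y t ω') ∂P))

/-- Almost every sample path is differentiable on `[0, ∞)` (one-sided at `0`). -/
def HasDifferentiablePaths (Y : ℝ≥0 → Ω → ℝ) (P : Measure Ω) : Prop :=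
  ∀ᵐ ω ∂P, DifferentiableOn ℝ (fun s : ℝ => Y s.toNNReal ω) (Set.Ici 0)

/-- The pathwise derivative process of `Y` on `[0, ∞)` (one-sided at `0`). -/
def pathDeriv (Y : ℝ≥0 → Ω → ℝ) (t : ℝ≥0) (ω : Ω) : ℝ :=
  derivWithin (fun s : ℝ => Y s.toNNReal ω) (Set.Ici 0) (t : ℝ)

/-- Almost surely `φ(t) = ∫₀ᵗ f(Y_{φ(s)}, Y'_{φ(s)}) ds` for all `t ≥ 0`, the integral being
well defined and finite. -/
def IsTimeChange (f : ℝ × ℝ → ℝ) (Y : ℝ≥0 → Ω → ℝ) (φ : ℝ≥0 → Ω → ℝ≥0) (P : Measure Ω) : Prop :=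
  ∀ᵐ ω ∂P, ∀ t : ℝ≥0,
    IntervalIntegrable
      (fun s : ℝ => f (Y (φ s.toNNReal ω) ω, pathDeriv Y (φ s.toNNReal ω) ω)) volume 0 t ∧
    (φ t ω : ℝ) =
      ∫ s in (0 : ℝ)..t, f (Y (φ s.toNNReal ω) ω, pathDeriv Y (φ s.toNNReal ω) ω)

/-- The law of a standard normal vector `U = (U₁, U₂)` in the plane. -/
def stdNormal2 : Measure (ℝ × ℝ) := (gaussianReal 0 1).prod (gaussianReal 0 1)

/-- `q₀ = E[1 / f(U)]`. -/
def q₀ (f : ℝ × ℝ → ℝ) : ℝ := ∫ p, 1 / f p ∂stdNormal2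

/-- The path `x` has an up-crossing of the level `u` at time `t > 0`: it equals `u` at `t`, is at
most `u` just before `t`, and at least `u` just after `t`. -/
def IsUpcrossing (x : ℝ≥0 → ℝ) (u : ℝ) (t : ℝ≥0) : Prop :=
  0 < t ∧ x t = u ∧ (∀ᶠ s in 𝓝[<] t, x s ≤ u) ∧ (∀ᶠ s in 𝓝[>] t, u ≤ x s)

/-- The up-crossings of the level `u` by the path `x` on the time interval `[0, T]`. -/
def upcrossings (x : ℝ≥0 → ℝ) (u : ℝ) (T : ℝ≥0) : Set ℝ≥0 :=
  {t | t ≤ T ∧ IsUpcrossing x u t}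

/-- `ν` is the up-crossing intensity of the level `u` for the path `x`: the number of up-crossings
on each `[0, T]` is finite and, divided by `T`, converges to `ν` as `T → ∞`. -/
def HasUpcrossingIntensity (x : ℝ≥0 → ℝ) (u ν : ℝ) : Prop :=
  (∀ T : ℝ≥0, (upcrossings x u T).Finite) ∧
    Tendsto (fun T : ℝ≥0 => ((upcrossings x u T).ncard : ℝ) / (T : ℝ)) atTop (𝓝 ν)

end TimeChange

end

noncomputable section

open scoped ENNReal

namespace TimeChange

/-! The theorem combines Rice's formula for `Y` with the mean speed of the clock.

Clock: with `k(s) = f(Y_s, Y'_s)`, the equation for `φ` inverts to `∫₀^{φ(T)} 1/k = T`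
(`SolvesTimeChange.setLIntegral_inv`). The pair `(Y₀, Y'₀)` is standard normal, so the ergodic
average of `1/k` is `q₀`. Hence `φ(T)/T → 1/q₀`, and `φ` is an increasing bijection of the
half-line, carrying up-crossings of `Z` to those of `Y` (`HasUpcrossingIntensity.comp_timeChange`).
A strictly increasing `h` preserves every comparison with the level, so `X` and `Z` have the same
up-crossings.

Rice's formula: crossings are compared with the measure of the times `s` at which `x(s) ≤ v < x(s +
δ)`, divided by `δ`. Each up-crossing contributes at least `δ` to this measure for small `δ`, so the
number of crossings in a unit window is at most the liminf `crossingBound`. By Fatou its mean is at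
most `ν = lim P(Y₀ ≤ v < Y_δ)/δ`; this gives finiteness and the upper bound for the intensity.
Conversely, where the liminf is finite, every strict passage from below to above contains a genuine
up-crossing, so the measure is at most `δ` times the number of crossings plus `δ`; averaging at
fixed `δ` and then letting `δ → 0` gives the lower bound (`IsErgodicLaw.hasUpcrossingIntensity`).

To compute `ν`, the midpoint and slope of `Y` over `[0, δ]` are used: they are jointly Gaussian and
uncorrelated, hence independent, and their variances tend to `1`. Given slope `z`, a step requires
the midpoint to lie in an interval of length about `δ z⁺` around `v`, so `ν` is the normal density
at `v` times `E[z⁺]` (`tendsto_stdNormal2_step`).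

Both `1/k` and `crossingBound` are unbounded, whereas ergodicity is assumed for bounded functionals.
Truncation and the maximal inequality bridge this gap (`IsErgodicLaw.tendsto_occupation`). -/

/-! ### The maximal ergodic inequality -/

section Maximal

variable {α : Type*}

/-- The points at which some Birkhoff average of order between `1` and `N` is at least `c`. -/
def largeAverageSet (τ : α → α) (g : α → ℝ≥0∞) (c : ℝ≥0∞) (N : ℕ) : Set α :=
  {x | ∃ n, 1 ≤ n ∧ n ≤ N ∧ n * c ≤ birkhoffSum τ g n x}

lemma birkhoffSum_mono (τ : α → α) (g : α → ℝ≥0∞) (x : α) :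
    Monotone fun n => birkhoffSum τ g n x := by
  refine monotone_nat_of_le_succ fun n => ?_
  simp only [birkhoffSum_succ]
  exact le_self_add

/-- Greedy covering of the orbit: from a point of the set, jump over a block of some length `n ≤ N`
on which the sum of `g` is at least `n * c`; from any other point advance by one, at no cost on the
left. The last block may overshoot time `M`, but by at most `N`. -/
lemma birkhoffSum_largeAverageSet_le (τ : α → α) (g : α → ℝ≥0∞) (c : ℝ≥0∞) (N M : ℕ) (x : α) :
    c * birkhoffSum τ ((largeAverageSet τ g c N).indicator 1) M x ≤
      birkhoffSum τ g (M + N) x := by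
  have hle : ∀ (m : ℕ) (z : α),
      birkhoffSum τ ((largeAverageSet τ g c N).indicator 1) m z ≤ (m : ℝ≥0∞) := by
    intro m z
    calc birkhoffSum τ ((largeAverageSet τ g c N).indicator 1) m z
        ≤ ∑ k ∈ Finset.range m, (1 : ℝ≥0∞) :=
          Finset.sum_le_sum fun k _ => Set.indicator_le_self' (by simp) _
      _ = m := by simp
  induction M using Nat.strong_induction_on generalizing x with
  | _ M ih =>
  rcases Nat.eq_zero_or_pos M with rfl | hM
  · simp
  by_cases hx : x ∈ largeAverageSet τ g c N
  · obtain ⟨n, hn1, hnN, hn⟩ := hx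
    rcases le_or_gt M n with hMn | hMn
    · calc c * birkhoffSum τ ((largeAverageSet τ g c N).indicator 1) M x
          ≤ c * n := by gcongr; exact (hle M x).trans (by exact_mod_cast hMn)
        _ ≤ birkhoffSum τ g n x := by rw [mul_comm]; exact hn
        _ ≤ _ := birkhoffSum_mono τ g x (by omega)
    · obtain ⟨m, rfl⟩ : ∃ m, M = n + m := ⟨M - n, by omega⟩
      rw [birkhoffSum_add, add_assoc n, birkhoffSum_add τ g, mul_add]
      refine add_le_add ?_ (ih m (by omega) _)
      refine le_trans ?_ hn
      rw [mul_comm]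
      gcongr
      exact hle n x
  · obtain ⟨m, rfl⟩ : ∃ m, M = 1 + m := ⟨M - 1, by omega⟩
    rw [birkhoffSum_add, add_assoc 1, birkhoffSum_add τ g, mul_add]
    refine add_le_add ?_ (ih m (by omega) _)
    simp [birkhoffSum_one, hx]

variable [MeasurableSpace α] {μ : Measure α}

lemma measurable_birkhoffSum {τ : α → α} (hτ : Measurable τ) {g : α → ℝ≥0∞} (hg : Measurable g)
    (n : ℕ) : Measurable (birkhoffSum τ g n) := by
  unfold birkhoffSum
  exact Finset.measurable_fun_sum _ fun k _ => hg.comp (hτ.iterate k)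

lemma lintegral_birkhoffSum {τ : α → α} (hτ : MeasurePreserving τ μ μ) {g : α → ℝ≥0∞}
    (hg : Measurable g) (n : ℕ) : ∫⁻ x, birkhoffSum τ g n x ∂μ = n * ∫⁻ x, g x ∂μ := by
  unfold birkhoffSum
  rw [lintegral_finsetSum (f := fun k x => g (τ^[k] x)) _
    fun k _ => hg.comp (hτ.measurable.iterate k)]
  simp [fun k => (hτ.iterate k).lintegral_comp hg]

lemma measurableSet_largeAverageSet {τ : α → α} (hτ : Measurable τ) {g : α → ℝ≥0∞}
    (hg : Measurable g) (c : ℝ≥0∞) (N : ℕ) : MeasurableSet (largeAverageSet τ g c N) := by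
  have : largeAverageSet τ g c N =
      ⋃ n ∈ Set.Icc 1 N, {x | (n : ℝ≥0∞) * c ≤ birkhoffSum τ g n x} := by
    ext x; simp [largeAverageSet, and_assoc]
  rw [this]
  exact MeasurableSet.biUnion (Set.to_countable _) fun n _ =>
    measurableSet_le measurable_const (measurable_birkhoffSum hτ hg n)

/-- Integrating the covering inequality over an invariant measure and dividing by `M` makes the `N`
surplus terms negligible as `M → ∞`. -/
lemma mul_measure_largeAverageSet_le [IsFiniteMeasure μ] {τ : α → α}
    (hτ : MeasurePreserving τ μ μ) {g : α → ℝ≥0∞} (hg : Measurable g)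
    (c : ℝ≥0∞) (N : ℕ) : c * μ (largeAverageSet τ g c N) ≤ ∫⁻ x, g x ∂μ := by
  set E := largeAverageSet τ g c N with hE_def
  have hE : MeasurableSet E := measurableSet_largeAverageSet hτ.measurable hg c N
  have key : ∀ M : ℕ, (M : ℝ≥0∞) * (c * μ E) ≤ ((M + N : ℕ) : ℝ≥0∞) * ∫⁻ x, g x ∂μ := by
    intro M
    have h := lintegral_mono (μ := μ) fun x => birkhoffSum_largeAverageSet_le τ g c N M x
    rw [lintegral_const_mul _ (measurable_birkhoffSum hτ.measurable
      (measurable_one.indicator hE) M), lintegral_birkhoffSum hτ (measurable_one.indicator hE),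
      lintegral_birkhoffSum hτ hg, lintegral_indicator_one hE] at h
    calc _ = _ := by ring
      _ ≤ _ := h
  by_cases hI : ∫⁻ x, g x ∂μ = ∞
  · simp [hI]
  have hlim : Tendsto (fun M : ℕ => ∫⁻ x, g x ∂μ + (M : ℝ≥0∞)⁻¹ * (N * ∫⁻ x, g x ∂μ)) atTop
      (𝓝 (∫⁻ x, g x ∂μ + 0 * (N * ∫⁻ x, g x ∂μ))) := by
    refine tendsto_const_nhds.add (ENNReal.Tendsto.mul_const ENNReal.tendsto_inv_nat_nhds_zero ?_)
    exact Or.inr (ENNReal.mul_ne_top (by simp) hI)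
  rw [zero_mul, add_zero] at hlim
  refine ge_of_tendsto hlim ?_
  filter_upwards [eventually_ge_atTop 1] with M hM
  have hM0 : (M : ℝ≥0∞) ≠ 0 := by simp; omega
  have hMt : (M : ℝ≥0∞) ≠ ∞ := by simp
  calc c * μ E = (M : ℝ≥0∞)⁻¹ * (M * (c * μ E)) := by
        rw [← mul_assoc, ENNReal.inv_mul_cancel hM0 hMt, one_mul]
    _ ≤ (M : ℝ≥0∞)⁻¹ * (((M + N : ℕ) : ℝ≥0∞) * ∫⁻ x, g x ∂μ) := mul_le_mul_right (key M) _
    _ = _ := by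
        push_cast
        rw [add_mul, mul_add, ← mul_assoc, ENNReal.inv_mul_cancel hM0 hMt, one_mul]

/-- The maximal ergodic inequality for nonnegative functions. -/
theorem mul_measure_exists_le_birkhoffSum_le [IsFiniteMeasure μ] {τ : α → α}
    (hτ : MeasurePreserving τ μ μ) {g : α → ℝ≥0∞} (hg : Measurable g) (c : ℝ≥0∞) :
    c * μ {x | ∃ n : ℕ, 1 ≤ n ∧ n * c ≤ birkhoffSum τ g n x} ≤ ∫⁻ x, g x ∂μ := by
  have hU : {x | ∃ n : ℕ, 1 ≤ n ∧ n * c ≤ birkhoffSum τ g n x} =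
      ⋃ N, largeAverageSet τ g c N := by
    ext x
    simp only [Set.mem_ofPred_eq, Set.mem_iUnion, largeAverageSet]
    exact ⟨fun ⟨n, h1, h2⟩ => ⟨n, n, h1, le_rfl, h2⟩, fun ⟨N, n, h1, _, h2⟩ => ⟨n, h1, h2⟩⟩
  have hmono : Monotone (largeAverageSet τ g c) := fun N N' h x ⟨n, h1, h2, h3⟩ =>
    ⟨n, h1, h2.trans h, h3⟩
  rw [hU, hmono.measure_iUnion, ENNReal.mul_iSup]
  exact iSup_le fun N => mul_measure_largeAverageSet_le hτ hg c N

end Maximal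

/-! ### The space of differentiable paths -/

/-- Differentiable paths on `[0, ∞)`, with the σ-algebra generated by the evaluations. -/
abbrev DiffPath : Type :=
  {y : ℝ≥0 → ℝ // DifferentiableOn ℝ (fun s : ℝ => y s.toNNReal) (Set.Ici 0)}

lemma DiffPath.continuous (y : DiffPath) : Continuous y.1 := by
  have h := (continuousOn_iff_continuous_domRestrict.1 y.2.continuousOn)
  have h2 : Continuous fun t : ℝ≥0 => (⟨(t : ℝ), t.2⟩ : Set.Ici (0 : ℝ)) := by fun_prop
  convert h.comp h2 using 1
  ext t
  simp

lemma measurable_eval : Measurable fun p : ℝ≥0 × DiffPath => p.2.1 p.1 :=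
  measurable_uncurry_of_continuous_of_measurable (u := fun t (y : DiffPath) => y.1 t)
    (fun y => y.continuous) (fun t => (measurable_pi_apply t).comp measurable_subtype_coe)

/-- The time shift of paths. -/
def shift (s : ℝ≥0) (y : DiffPath) : DiffPath :=
  ⟨fun t => y.1 (t + s), by
    have h : DifferentiableOn ℝ (fun r : ℝ => y.1 (r + s).toNNReal) (Set.Ici 0) :=
      y.2.comp (by fun_prop) fun r (hr : 0 ≤ r) => by
        have := s.2
        simp only [Set.mem_Ici]; positivity
    refine h.congr fun r (hr : 0 ≤ r) => ?_
    simp only [Real.toNNReal_add hr s.coe_nonneg, Real.toNNReal_coe]⟩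

@[simp] lemma shift_apply (s : ℝ≥0) (y : DiffPath) (t : ℝ≥0) : (shift s y).1 t = y.1 (t + s) := rfl

lemma measurable_shift_prod : Measurable fun p : ℝ≥0 × DiffPath => shift p.1 p.2 := by
  refine Measurable.subtype_mk (measurable_pi_iff.2 fun t => ?_)
  exact measurable_eval.comp ((measurable_const.add measurable_fst).prodMk measurable_snd)

@[fun_prop]
lemma measurable_shift_comp {β : Type*} [MeasurableSpace β] {a : β → ℝ≥0} {b : β → DiffPath}
    (ha : Measurable a) (hb : Measurable b) : Measurable fun x => shift (a x) (b x) :=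
  measurable_shift_prod.comp (ha.prodMk hb)

lemma measurable_shift (s : ℝ≥0) : Measurable (shift s) := by fun_prop

lemma shift_shift (s t : ℝ≥0) (y : DiffPath) : shift s (shift t y) = shift (s + t) y := by
  ext r; simp [add_assoc]

lemma shift_zero (y : DiffPath) : shift 0 y = y := by ext r; simp

lemma shift_one_iterate (n : ℕ) : (shift 1)^[n] = shift n := by
  induction n with
  | zero => ext y r; simp
  | succ n ih => ext y r; rw [Function.iterate_succ', ih]; simp [add_left_comm, add_comm]

/-- A law on path space that is stationary and satisfies the ergodic theorem for bounded
functionals. -/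
structure IsErgodicLaw (μ : Measure DiffPath) : Prop where
  map_shift : ∀ s, μ.map (shift s) = μ
  tendsto_average : ∀ g : DiffPath → ℝ, Measurable g → (∃ C : ℝ, ∀ y, |g y| ≤ C) →
    ∀ᵐ y ∂μ, Tendsto (fun H : ℝ => H⁻¹ * ∫ s in (0 : ℝ)..H, g (shift s.toNNReal y))
      atTop (𝓝 (∫ y', g y' ∂μ))

/-- The integral of a functional along the shifts of a path over the times in `(0, H]`. -/
def occupation (g : DiffPath → ℝ≥0∞) (H : ℝ) (y : DiffPath) : ℝ≥0∞ :=
  ∫⁻ s in Set.Ioc 0 H, g (shift s.toNNReal y)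

section Occupation

variable {g : DiffPath → ℝ≥0∞}

lemma measurable_occupation (hg : Measurable g) (H : ℝ) : Measurable (occupation g H) := by
  unfold occupation
  refine Measurable.lintegral_prod_right' (f := fun p : DiffPath × ℝ => g (shift p.2.toNNReal p.1))
    (by fun_prop)

lemma occupation_mono {H H' : ℝ} (h : H ≤ H') (y : DiffPath) :
    occupation g H y ≤ occupation g H' y :=
  lintegral_mono_set (Set.Ioc_subset_Ioc_right h)

lemma occupation_add (hg : Measurable g) {a b : ℝ} (ha : 0 ≤ a) (hb : 0 ≤ b) (y : DiffPath) :
    occupation g (a + b) y = occupation g a y + occupation g b (shift a.toNNReal y) := by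
  unfold occupation
  rw [← Set.Ioc_union_Ioc_eq_Ioc ha (by linarith : a ≤ a + b),
    lintegral_union measurableSet_Ioc (Set.Ioc_disjoint_Ioc_of_le le_rfl)]
  congr 1
  rw [← (measurePreserving_add_right volume a).setLIntegral_comp_preimage measurableSet_Ioc
    (f := fun s => g (shift s.toNNReal y)) (by fun_prop)]
  simp only [Set.preimage_add_const_Ioc, sub_self, add_sub_cancel_left]
  refine setLIntegral_congr_fun measurableSet_Ioc fun s hs => ?_
  simp [shift_shift, Real.toNNReal_add hs.1.le ha]

/-- Reduces continuous time to iterates of `shift 1`, where the maximal inequality applies. -/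
lemma occupation_nat (hg : Measurable g) (n : ℕ) (y : DiffPath) :
    occupation g n y = birkhoffSum (shift 1) (occupation g 1) n y := by
  induction n with
  | zero => simp [occupation]
  | succ n ih =>
    rw [birkhoffSum_succ, ← ih, shift_one_iterate]
    push_cast
    rw [occupation_add hg n.cast_nonneg zero_le_one]
    simp

lemma lintegral_occupation {μ : Measure DiffPath} [IsProbabilityMeasure μ] (hμ : IsErgodicLaw μ)
    (hg : Measurable g) (H : ℝ) :
    ∫⁻ y, occupation g H y ∂μ = ENNReal.ofReal H * ∫⁻ y, g y ∂μ := by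
  unfold occupation
  rw [lintegral_lintegral_swap]
  · have : ∀ s : ℝ, ∫⁻ y, g (shift s.toNNReal y) ∂μ = ∫⁻ y, g y ∂μ := fun s => by
      rw [← lintegral_map hg (measurable_shift _), hμ.map_shift]
    simp [this, mul_comm]
  · unfold Function.uncurry
    fun_prop

end Occupation

/-! ### The ergodic theorem: from bounded to integrable functionals. -/

section ErgodicTheorem

variable {g : DiffPath → ℝ≥0∞} {μ : Measure DiffPath} [IsProbabilityMeasure μ]

lemma occupation_add_fun {g₁ g₂ : DiffPath → ℝ≥0∞} (hg₁ : Measurable g₁) (H : ℝ)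
    (y : DiffPath) :
    occupation (fun z => g₁ z + g₂ z) H y = occupation g₁ H y + occupation g₂ H y := by
  unfold occupation
  exact lintegral_add_left (f := fun s : ℝ => g₁ (shift s.toNNReal y)) (by fun_prop) _

lemma occupation_le_of_le {g₁ g₂ : DiffPath → ℝ≥0∞} (h : ∀ z, g₁ z ≤ g₂ z) (H : ℝ)
    (y : DiffPath) : occupation g₁ H y ≤ occupation g₂ H y :=
  lintegral_mono fun _ => h _

lemma IsErgodicLaw.tendsto_occupation_of_le (hμ : IsErgodicLaw μ) (hg : Measurable g)
    {K : ℝ≥0} (hK : ∀ y, g y ≤ K) :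
    ∀ᵐ y ∂μ, Tendsto (fun H : ℝ => (ENNReal.ofReal H)⁻¹ * occupation g H y) atTop
      (𝓝 (∫⁻ y, g y ∂μ)) := by
  have hfin : ∀ y, g y < ∞ := fun y => (hK y).trans_lt ENNReal.coe_lt_top
  have h := hμ.tendsto_average (fun y => (g y).toReal) hg.ennreal_toReal
    ⟨K, fun y => by
      rw [abs_of_nonneg ENNReal.toReal_nonneg]
      exact ENNReal.toReal_le_coe_of_le_coe (hK y)⟩
  filter_upwards [h] with y hy
  have hI : ∫⁻ y, g y ∂μ ≠ ∞ := by
    refine ne_top_of_le_ne_top (b := (K : ℝ≥0∞)) (by simp) ?_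
    calc ∫⁻ y, g y ∂μ ≤ ∫⁻ _, (K : ℝ≥0∞) ∂μ := lintegral_mono hK
      _ = K := by simp
  rw [integral_toReal hg.aemeasurable (ae_of_all _ hfin)] at hy
  have hy' := ENNReal.tendsto_ofReal hy
  rw [ENNReal.ofReal_toReal hI] at hy'
  refine hy'.congr' ?_
  filter_upwards [eventually_gt_atTop 0] with H hH
  have hocc : occupation g H y ≠ ∞ := by
    refine ne_top_of_le_ne_top (b := (K : ℝ≥0∞) * ENNReal.ofReal H)
      (ENNReal.mul_ne_top (by simp) (by simp)) ?_
    calc occupation g H y ≤ ∫⁻ _ in Set.Ioc 0 H, (K : ℝ≥0∞) := lintegral_mono fun _ => hK _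
      _ = K * ENNReal.ofReal H := by simp
  rw [intervalIntegral.integral_of_le hH.le,
    integral_toReal (f := fun s : ℝ => g (shift s.toNNReal y))
      (Measurable.aemeasurable (by fun_prop)) (ae_of_all _ fun _ => hfin _),
    ENNReal.ofReal_mul (by positivity), ENNReal.ofReal_inv_of_pos hH]
  congr 1
  exact ENNReal.ofReal_toReal hocc

/-- The exceptional set lies in the maximal set of every `r K` at once, so `c` times its measure is
at most each `∫ r K`, and these tend to `0`. -/
lemma ae_exists_forall_occupation_lt (hμ : IsErgodicLaw μ) {r : ℕ → DiffPath → ℝ≥0∞}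
    (hr : ∀ K, Measurable (r K)) (hlim : Tendsto (fun K => ∫⁻ y, r K y ∂μ) atTop (𝓝 0))
    {c : ℝ≥0∞} (hc : c ≠ 0) :
    ∀ᵐ y ∂μ, ∃ K, ∀ n : ℕ, 1 ≤ n → occupation (r K) n y < n * c := by
  have hτ : MeasurePreserving (shift 1) μ μ := ⟨measurable_shift 1, hμ.map_shift 1⟩
  set B := {y | ¬ ∃ K, ∀ n : ℕ, 1 ≤ n → occupation (r K) n y < n * c} with hB
  have hle : ∀ K, c * μ B ≤ ∫⁻ y, r K y ∂μ := fun K => by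
    have h := mul_measure_exists_le_birkhoffSum_le hτ (measurable_occupation (hr K) 1) c
    rw [lintegral_occupation hμ (hr K), ENNReal.ofReal_one, one_mul] at h
    refine le_trans (mul_le_mul_right (measure_mono fun y hy => ?_) _) h
    have hy' : ¬ ∃ K, ∀ n : ℕ, 1 ≤ n → occupation (r K) n y < n * c := hy
    push Not at hy'
    obtain ⟨n, hn, hn'⟩ := hy' K
    exact ⟨n, hn, by rwa [← occupation_nat (hr K)]⟩
  have h0 : c * μ B ≤ 0 := ge_of_tendsto' hlim hle
  have := mul_eq_zero.1 (nonpos_iff_eq_zero.1 h0)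
  exact this.resolve_left hc

/-- The pointwise ergodic theorem for integrable nonnegative functionals. -/
theorem IsErgodicLaw.tendsto_occupation (hμ : IsErgodicLaw μ) (hg : Measurable g)
    (hint : ∫⁻ y, g y ∂μ ≠ ∞) :
    ∀ᵐ y ∂μ, Tendsto (fun H : ℝ => (ENNReal.ofReal H)⁻¹ * occupation g H y) atTop
      (𝓝 (∫⁻ y, g y ∂μ)) := by
  set gK : ℕ → DiffPath → ℝ≥0∞ := fun K y => min (g y) K with hgK
  have hgKm : ∀ K, Measurable (gK K) := fun K => hg.min measurable_const
  set r : ℕ → DiffPath → ℝ≥0∞ := fun K y => g y - gK K y with hr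
  have hrm : ∀ K, Measurable (r K) := fun K => hg.sub (hgKm K)
  have hsum : ∀ K y, gK K y + r K y = g y := fun K y => add_tsub_cancel_of_le (min_le_left _ _)
  have hfin : ∀ᵐ y ∂μ, g y < ∞ := ae_lt_top hg hint
  have hev : ∀ y, g y < ∞ → ∀ᶠ K : ℕ in atTop, gK K y = g y := fun y hy => by
    obtain ⟨n, hn⟩ := ENNReal.exists_nat_gt hy.ne
    filter_upwards [eventually_ge_atTop n] with K hK
    exact min_eq_left (hn.le.trans (by exact_mod_cast hK))
  have hgKlim : Tendsto (fun K => ∫⁻ y, gK K y ∂μ) atTop (𝓝 (∫⁻ y, g y ∂μ)) := by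
    refine tendsto_lintegral_of_dominated_convergence g hgKm
      (fun K => ae_of_all _ fun y => min_le_left _ _) hint ?_
    filter_upwards [hfin] with y hy
    exact tendsto_const_nhds.congr' ((hev y hy).mono fun K hK => hK.symm)
  have hrlim : Tendsto (fun K => ∫⁻ y, r K y ∂μ) atTop (𝓝 0) := by
    have := tendsto_lintegral_of_dominated_convergence (μ := μ) (F := r) (f := fun _ => 0) g hrm
      (fun K => ae_of_all _ fun y => tsub_le_self) hint (by
        filter_upwards [hfin] with y hy
        refine tendsto_const_nhds.congr' ((hev y hy).mono fun K hK => ?_)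
        simp [hr, hK])
    simpa using this
  have h1 : ∀ᵐ y ∂μ, ∀ K : ℕ, Tendsto (fun H : ℝ => (ENNReal.ofReal H)⁻¹ * occupation (gK K) H y)
      atTop (𝓝 (∫⁻ y, gK K y ∂μ)) := ae_all_iff.2 fun K =>
    hμ.tendsto_occupation_of_le (K := (K : ℝ≥0)) (hgKm K) fun y => by simp [hgK]
  have h2 : ∀ᵐ y ∂μ, ∀ m : ℕ, ∃ K, ∀ n : ℕ, 1 ≤ n →
      occupation (r K) n y < n * ((m + 1 : ℕ) : ℝ≥0∞)⁻¹ := ae_all_iff.2 fun m =>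
    ae_exists_forall_occupation_lt hμ hrm hrlim (by simp)
  filter_upwards [h1, h2] with y hy1 hy2
  refine tendsto_order.2 ⟨fun a ha => ?_, fun b hb => ?_⟩
  · obtain ⟨K, hK⟩ := ((tendsto_order.1 hgKlim).1 a ha).exists
    filter_upwards [(tendsto_order.1 (hy1 K)).1 a hK] with H hH
    refine hH.trans_le (mul_le_mul_right (occupation_le_of_le (fun z => min_le_left _ _) H y) _)
  -- The lower bound needed only `gK K ≤ g`. For the upper bound the remainder `r K` is controlled
  -- at integer times; passing to real `H ≥ 1` costs the factor `2`, since `⌈H⌉ ≤ 2 H`.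
  · have hm : Tendsto (fun m : ℕ => ∫⁻ y, g y ∂μ + 2 * ((m + 1 : ℕ) : ℝ≥0∞)⁻¹) atTop
        (𝓝 (∫⁻ y, g y ∂μ + 2 * 0)) := by
      refine tendsto_const_nhds.add (ENNReal.Tendsto.const_mul ?_ (Or.inr (by simp)))
      exact ENNReal.tendsto_inv_nat_nhds_zero.comp (tendsto_add_atTop_nat 1)
    rw [mul_zero, add_zero] at hm
    obtain ⟨m, hm⟩ := ((tendsto_order.1 hm).2 b hb).exists
    obtain ⟨K, hK⟩ := hy2 m
    set c : ℝ≥0∞ := ((m + 1 : ℕ) : ℝ≥0∞)⁻¹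
    have hlt : ∫⁻ y, gK K y ∂μ + 2 * c < b :=
      lt_of_le_of_lt (by gcongr with z; exact min_le_left _ _) hm
    filter_upwards [(tendsto_order.1 ((hy1 K).add_const (2 * c))).2 b hlt,
      eventually_ge_atTop 1] with H hH hH1
    refine lt_of_le_of_lt ?_ hH
    have hH0 : (0 : ℝ) < H := by linarith
    have hocc : occupation g H y = occupation (gK K) H y + occupation (r K) H y := by
      rw [← occupation_add_fun (hgKm K)]
      simp only [hsum]
    rw [hocc, mul_add]
    refine add_le_add le_rfl ?_
    have hn1 : 1 ≤ ⌈H⌉₊ := Nat.one_le_ceil_iff.2 hH0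
    have hn2 : (⌈H⌉₊ : ℝ) ≤ 2 * H := by linarith [Nat.ceil_lt_add_one hH0.le]
    have hn3 : (⌈H⌉₊ : ℝ≥0∞) ≤ 2 * ENNReal.ofReal H := by
      rw [← ENNReal.ofReal_natCast]
      refine (ENNReal.ofReal_le_ofReal hn2).trans_eq ?_
      rw [ENNReal.ofReal_mul (by norm_num)]; simp
    calc (ENNReal.ofReal H)⁻¹ * occupation (r K) H y
        ≤ (ENNReal.ofReal H)⁻¹ * (⌈H⌉₊ * c) := by
          gcongr
          exact (occupation_mono (Nat.le_ceil H) y).trans (hK _ hn1).le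
      _ ≤ (ENNReal.ofReal H)⁻¹ * (2 * ENNReal.ofReal H * c) := by gcongr
      _ = ((ENNReal.ofReal H)⁻¹ * ENNReal.ofReal H) * (2 * c) := by ring
      _ = 2 * c := by
          rw [ENNReal.inv_mul_cancel (by simpa using hH0) (by simp), one_mul]

lemma IsErgodicLaw.occupation_lt_top (hμ : IsErgodicLaw μ) (hg : Measurable g)
    (hint : ∫⁻ y, g y ∂μ ≠ ∞) : ∀ᵐ y ∂μ, ∀ H : ℝ, occupation g H y < ∞ := by
  have h : ∀ᵐ y ∂μ, ∀ n : ℕ, occupation g n y < ∞ := ae_all_iff.2 fun n =>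
    ae_lt_top (measurable_occupation hg n) (by
      rw [lintegral_occupation hμ hg]
      exact ENNReal.mul_ne_top (by simp) hint)
  filter_upwards [h] with y hy H
  obtain ⟨n, hn⟩ := exists_nat_ge H
  exact (occupation_mono hn y).trans_lt (hy n)

end ErgodicTheorem

/-! ### Up-crossings of continuous functions -/

/-- The times `s` in `(a, b)` such that `x` steps over the level `v` between `s` and `s + δ`. -/
def stepSet (x : ℝ → ℝ) (v δ a b : ℝ) : Set ℝ :=
  {s | s ∈ Set.Ioo a b ∧ x s ≤ v ∧ v < x (s + δ)}

/-- Up-crossings of a function on the real line. -/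
def IsRealUpcrossing (x : ℝ → ℝ) (v t : ℝ) : Prop :=
  x t = v ∧ (∀ᶠ s in 𝓝[<] t, x s ≤ v) ∧ ∀ᶠ s in 𝓝[>] t, v ≤ x s

/-- A sequence of step lengths decreasing to `0`. -/
def mesh (n : ℕ) : ℝ := 1 / ((n : ℝ) + 1)

lemma mesh_pos (n : ℕ) : 0 < mesh n := by unfold mesh; positivity

lemma mesh_le_one (n : ℕ) : mesh n ≤ 1 := by
  unfold mesh
  rw [div_le_one (by positivity)]
  linarith [n.cast_nonneg (α := ℝ)]

lemma tendsto_mesh : Tendsto mesh atTop (𝓝[>] 0) :=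
  tendsto_nhdsWithin_iff.2
    ⟨tendsto_one_div_add_atTop_nhds_zero_nat, Eventually.of_forall mesh_pos⟩

section Deterministic

variable {x : ℝ → ℝ} {v : ℝ}

lemma measurableSet_stepSet (hx : Continuous x) (v δ a b : ℝ) :
    MeasurableSet (stepSet x v δ a b) :=
  measurableSet_Ioo.inter ((measurableSet_le hx.measurable measurable_const).inter
    (measurableSet_lt measurable_const (hx.measurable.comp (measurable_add_const δ))))

lemma volume_stepSet_mono (v δ : ℝ) {a b a' b' : ℝ} (ha : a' ≤ a) (hb : b ≤ b') :
    volume (stepSet x v δ a b) ≤ volume (stepSet x v δ a' b') :=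
  measure_mono fun _ hs => ⟨Set.Ioo_subset_Ioo ha hb hs.1, hs.2⟩

lemma volume_stepSet_add_le (hx : Continuous x) (v δ : ℝ) {a b c d : ℝ} (hab : a ≤ b) (hbc : b ≤ c)
    (hcd : c ≤ d) :
    volume (stepSet x v δ a b) + volume (stepSet x v δ c d) ≤ volume (stepSet x v δ a d) := by
  rw [← measure_union ?_ (measurableSet_stepSet hx _ _ _ _)]
  · refine measure_mono (Set.union_subset ?_ ?_)
    · exact fun s hs => ⟨Set.Ioo_subset_Ioo_right (hbc.trans hcd) hs.1, hs.2⟩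
    · exact fun s hs => ⟨Set.Ioo_subset_Ioo_left (hab.trans hbc) hs.1, hs.2⟩
  · refine Set.disjoint_left.2 fun s hs hs' => ?_
    have := hs.1.2; have := hs'.1.1
    linarith

/-- Compare `E = {x > v}` on `(a + δ, b)` and on `(a + δ, b + δ)`. The second is larger by `δ`,
because `x > v` near `b`. Translated back by `δ`, it consists of the `s` in `(a, b)` with `x (s + δ)
> v`; such an `s` is a step or lies in `E`, and in the latter case `s ≥ a + δ` up to a null set,
because `x < v` near `a`. -/
lemma eventually_le_volume_stepSet (hx : Continuous x) {a b : ℝ} (hab : a < b) (ha : x a < v)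
    (hb : v < x b) : ∀ᶠ δ in 𝓝[>] (0 : ℝ), ENNReal.ofReal δ ≤ volume (stepSet x v δ a b) := by
  have h1 : ∀ᶠ s in 𝓝 a, x s < v := hx.continuousAt.eventually_lt_const ha
  have h2 : ∀ᶠ s in 𝓝 b, v < x s := hx.continuousAt.eventually_const_lt hb
  obtain ⟨η₁, hη₁, h1⟩ := Metric.eventually_nhds_iff.1 h1
  obtain ⟨η₂, hη₂, h2⟩ := Metric.eventually_nhds_iff.1 h2
  have hm : 0 < min (min η₁ η₂) (b - a) := by
    have := sub_pos.2 hab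
    positivity
  filter_upwards [Ioo_mem_nhdsGT hm] with δ ⟨hδ0, hδ⟩
  have hδ1 : δ < η₁ := hδ.trans_le ((min_le_left _ _).trans (min_le_left _ _))
  have hδ2 : δ < η₂ := hδ.trans_le ((min_le_left _ _).trans (min_le_right _ _))
  have hδ3 : δ < b - a := hδ.trans_le (min_le_right _ _)
  set E : Set ℝ := {s | v < x s} with hE_def
  have hE : MeasurableSet E := measurableSet_lt measurable_const hx.measurable
  set A := Set.Ioo (a + δ) b ∩ E with hA
  have hAfin : volume A ≠ ∞ :=
    ((measure_mono Set.inter_subset_left).trans_lt (measure_Ioo_lt_top (a := a + δ) (b := b))).ne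
  have hlow : volume A + ENNReal.ofReal δ ≤ volume (Set.Ioo (a + δ) (b + δ) ∩ E) := by
    have : ENNReal.ofReal δ = volume (Set.Ico b (b + δ)) := by simp
    rw [this, ← measure_union ?_ measurableSet_Ico]
    · refine measure_mono (Set.union_subset ?_ ?_)
      · rintro s ⟨⟨hs1, hs2⟩, hs3⟩
        exact ⟨⟨hs1, by linarith⟩, hs3⟩
      · rintro s ⟨hs1, hs2⟩
        refine ⟨⟨by linarith, hs2⟩, h2 ?_⟩
        rw [Real.dist_eq, abs_of_nonneg (by linarith)]
        linarith
    · refine Set.disjoint_left.2 fun s hs hs' => ?_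
      have := hs.1.2; have := hs'.1
      linarith
  have htrans : volume (Set.Ioo (a + δ) (b + δ) ∩ E) =
      volume {s | s ∈ Set.Ioo a b ∧ v < x (s + δ)} := by
    rw [← (measurePreserving_add_right volume δ).measure_preimage
      (measurableSet_Ioo.inter hE).nullMeasurableSet]
    congr 1
    ext s
    simp [hE_def]
  have hup : volume {s | s ∈ Set.Ioo a b ∧ v < x (s + δ)} ≤
      volume A + volume (stepSet x v δ a b) := by
    refine (measure_mono fun s hs => ?_).trans (measure_union_le _ _)
    obtain ⟨⟨hs1, hs2⟩, hs3⟩ := hs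
    rcases le_or_gt (x s) v with h | h
    · exact Or.inr ⟨⟨hs1, hs2⟩, h, hs3⟩
    · refine Or.inl ⟨⟨?_, hs2⟩, h⟩
      by_contra hcon
      have : dist s a < η₁ := by
        rw [Real.dist_eq, abs_of_nonneg (by linarith)]
        linarith
      exact absurd (h1 this) (not_lt.2 h.le)
  exact (ENNReal.add_le_add_iff_left hAfin).1 (hlow.trans (htrans.le.trans hup))

/-- If the normalized measure of the step sets does not diverge, then every passage from below to
above the level contains an up-crossing. -/
lemma exists_isRealUpcrossing (hx : Continuous x) (M : ℕ) {a b : ℝ} (hab : a < b) (ha : x a < v)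
    (hb : v < x b)
    (hM : ∃ᶠ n in atTop, volume (stepSet x v (mesh n) a b) ≤ M * ENNReal.ofReal (mesh n)) :
    ∃ t ∈ Set.Ioo a b, IsRealUpcrossing x v t := by
  induction M generalizing a b with
  | zero =>
    obtain ⟨n, h1, h2⟩ :=
      (hM.and_eventually (tendsto_mesh.eventually (eventually_le_volume_stepSet hx hab ha hb))).exists
    have := h2.trans h1
    simp [(mesh_pos n).not_ge] at this
  | succ M ih =>
    -- The induction is on the budget `M` of normalized step measure. If the path comes back down
    -- from `q` to `p`, the passage over `(p, b)` uses one unit, leaving `M` for `(a, q)`.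
    by_cases hex : ∃ q p, a < q ∧ q < p ∧ p < b ∧ v < x q ∧ x p < v
    · obtain ⟨q, p, haq, hqp, hpb, hq, hp⟩ := hex
      have key : ∃ t ∈ Set.Ioo a q, IsRealUpcrossing x v t := by
        refine ih haq ha hq ?_
        refine (hM.and_eventually (tendsto_mesh.eventually
          (eventually_le_volume_stepSet hx hpb hp hb))).mono fun n hn => ?_
        have h := volume_stepSet_add_le hx v (mesh n) haq.le hqp.le hpb.le
        have h' : volume (stepSet x v (mesh n) a q) + ENNReal.ofReal (mesh n) ≤
            M * ENNReal.ofReal (mesh n) + ENNReal.ofReal (mesh n) :=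
          calc _ ≤ volume (stepSet x v (mesh n) a q) + volume (stepSet x v (mesh n) p b) :=
                add_le_add le_rfl hn.2
            _ ≤ _ := h
            _ ≤ _ := hn.1
            _ = _ := by push_cast; ring
        exact (ENNReal.add_le_add_iff_right (by simp)).1 h'
      obtain ⟨t, ht, h⟩ := key
      exact ⟨t, ⟨ht.1, ht.2.trans (hqp.trans hpb)⟩, h⟩
    -- Otherwise a path that has once been above the level is never below it again before `b`, and
    -- the last time below the level is an up-crossing.
    · push Not at hex
      set S := {s | s ∈ Set.Icc a b ∧ x s < v} with hS
      have haS : a ∈ S := ⟨⟨le_rfl, hab.le⟩, ha⟩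
      have hbdd : BddAbove S := ⟨b, fun s hs => hs.1.2⟩
      set c := sSup S with hc
      have hac : a ≤ c := le_csSup hbdd haS
      have hcb : c ≤ b := csSup_le ⟨a, haS⟩ fun s hs => hs.1.2
      have hxc : x c ≤ v := by
        have hcl : c ∈ closure S := csSup_mem_closure ⟨a, haS⟩ hbdd
        have hsub : S ⊆ {s | x s ≤ v} := fun s hs => hs.2.le
        exact closure_minimal hsub (isClosed_le hx continuous_const) hcl
      have hcb' : c < b := lt_of_le_of_ne hcb fun h => by rw [h] at hxc; linarith
      have hright : ∀ s ∈ Set.Ioo c b, v ≤ x s := fun s hs => by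
        by_contra hcon
        have : s ≤ c := le_csSup hbdd ⟨⟨hac.trans hs.1.le, hs.2.le⟩, not_le.1 hcon⟩
        linarith [hs.1]
      have hevr : ∀ᶠ s in 𝓝[>] c, v ≤ x s := by
        filter_upwards [Ioo_mem_nhdsGT hcb'] with s hs using hright s hs
      have hxc' : v ≤ x c :=
        ge_of_tendsto (hx.continuousAt.tendsto.mono_left nhdsWithin_le_nhds) hevr
      have hac' : a < c := lt_of_le_of_ne hac fun h => by rw [← h] at hxc'; linarith
      refine ⟨c, ⟨hac', hcb'⟩, le_antisymm hxc hxc', ?_, hevr⟩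
      filter_upwards [Ioo_mem_nhdsLT hac'] with s hs
      by_contra hcon
      obtain ⟨p, hp, hsp⟩ := exists_lt_of_lt_csSup ⟨a, haS⟩ hs.2
      have hpc : p ≤ c := le_csSup hbdd hp
      exact absurd hp.2 (not_lt.2 (hex s p hs.1 hsp (hpc.trans_lt hcb') (not_le.1 hcon)))

/-- A null level set rules out flat stretches at the level, so the weak inequality in the definition
of an up-crossing is strict at points arbitrarily close by. -/
lemma exists_lt_near_left (hnull : volume ({s | x s = v} ∩ Set.Ioi 0) = 0) {m t : ℝ} (hm : 0 ≤ m)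
    (hmt : m < t) (h : ∀ᶠ s in 𝓝[<] t, x s ≤ v) : ∃ p ∈ Set.Ioo m t, x p < v := by
  obtain ⟨l, hl, hl'⟩ := (mem_nhdsLT_iff_exists_Ioo_subset' hmt).1 h
  have hpos : max l m < t := max_lt hl hmt
  obtain ⟨p, hp, hp'⟩ : (Set.Ioo (max l m) t \ ({s | x s = v} ∩ Set.Ioi 0)).Nonempty := by
    refine nonempty_of_measure_ne_zero (μ := volume) ?_
    rw [measure_sdiff_null hnull]
    simp [hpos.not_ge]
  have hmp : m < p := (le_max_right _ _).trans_lt hp.1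
  refine ⟨p, ⟨hmp, hp.2⟩, lt_of_le_of_ne (hl' ⟨(le_max_left _ _).trans_lt hp.1, hp.2⟩) fun hv => ?_⟩
  exact hp' ⟨hv, hm.trans_lt hmp⟩

lemma exists_gt_near_right (hnull : volume ({s | x s = v} ∩ Set.Ioi 0) = 0) {t b : ℝ} (ht : 0 ≤ t)
    (htb : t < b) (h : ∀ᶠ s in 𝓝[>] t, v ≤ x s) : ∃ q ∈ Set.Ioo t b, v < x q := by
  obtain ⟨l, hl, hl'⟩ := (mem_nhdsGT_iff_exists_Ioo_subset' htb).1 h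
  have hpos : t < min l b := lt_min hl htb
  obtain ⟨q, hq, hq'⟩ : (Set.Ioo t (min l b) \ ({s | x s = v} ∩ Set.Ioi 0)).Nonempty := by
    refine nonempty_of_measure_ne_zero (μ := volume) ?_
    rw [measure_sdiff_null hnull]
    simp [hpos.not_ge]
  refine ⟨q, ⟨hq.1, hq.2.trans_le (min_le_right _ _)⟩,
    lt_of_le_of_ne (hl' ⟨hq.1, hq.2.trans_le (min_le_left _ _)⟩) fun hv => ?_⟩
  exact hq' ⟨hv.symm, ht.trans_lt hq.1⟩

/-- The normalized measure of the step sets is eventually at least the number of up-crossings. -/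
lemma eventually_card_mul_le (hx : Continuous x) (hnull : volume ({s | x s = v} ∩ Set.Ioi 0) = 0)
    {a b : ℝ} (ha : 0 ≤ a) (F : Finset ℝ) (hF : ∀ t ∈ F, t ∈ Set.Ioo a b)
    (hup : ∀ t ∈ F, IsRealUpcrossing x v t) :
    ∀ᶠ δ in 𝓝[>] (0 : ℝ), (F.card : ℝ≥0∞) * ENNReal.ofReal δ ≤ volume (stepSet x v δ a b) := by
  induction F using Finset.induction_on_max generalizing b with
  | empty => simp
  | insert t F hmax ih =>
    have ht := hF t (Finset.mem_insert_self _ _)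
    have htup := hup t (Finset.mem_insert_self _ _)
    -- The point `m` separates the last crossing `t` from the earlier ones: the induction hypothesis
    -- covers `(a, m)`, and a strict passage from `p` to `q` around `t` inside `(m, b)` adds one
    -- more `δ`.
    have hm : ∀ᶠ m in 𝓝[<] t, m ∈ Set.Ioo a t ∧ ∀ s ∈ F, s < m := by
      refine Filter.Eventually.and (Ioo_mem_nhdsLT ht.1) ?_
      refine (Filter.eventually_all_finset F).2 fun s hs => ?_
      exact (eventually_gt_nhds (hmax s hs)).filter_mono nhdsWithin_le_nhds
    obtain ⟨m, hm1, hm2⟩ := hm.exists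
    obtain ⟨p, hp, hxp⟩ := exists_lt_near_left hnull (ha.trans hm1.1.le) hm1.2 htup.2.1
    obtain ⟨q, hq, hxq⟩ := exists_gt_near_right hnull (ha.trans ht.1.le) ht.2 htup.2.2
    have hF' := ih (b := m)
      (fun s hs => ⟨(hF s (Finset.mem_insert_of_mem hs)).1, hm2 s hs⟩)
      fun s hs => hup s (Finset.mem_insert_of_mem hs)
    filter_upwards [hF', eventually_le_volume_stepSet hx (hp.2.trans hq.1) hxp hxq] with δ h1 h2
    rw [Finset.card_insert_of_notMem fun h => lt_irrefl _ (hmax t h)]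
    push_cast
    rw [add_mul, one_mul]
    exact (add_le_add h1 h2).trans
      ((volume_stepSet_add_le hx v δ hm1.1.le hp.1.le (hp.2.trans hq.1).le).trans
        (volume_stepSet_mono v δ le_rfl hq.2.le))

end Deterministic

/-! ### The up-crossing intensity of an ergodic path -/

/-- The extension of a path to the real line that is constant on `(-∞, 0]`. -/
def DiffPath.extend (y : DiffPath) (s : ℝ) : ℝ := y.1 s.toNNReal

lemma DiffPath.continuous_extend (y : DiffPath) : Continuous y.extend :=
  y.continuous.comp continuous_real_toNNReal

lemma isUpcrossing_iff (y : DiffPath) (v : ℝ) {t : ℝ≥0} (ht : 0 < t) :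
    IsUpcrossing y.1 v t ↔ IsRealUpcrossing y.extend v t := by
  have hcoe : ∀ s : ℝ≥0, y.extend s = y.1 s := fun s => by simp [DiffPath.extend]
  have hc : Tendsto ((↑) : ℝ≥0 → ℝ) (𝓝 t) (𝓝 (t : ℝ)) := NNReal.continuous_coe.continuousAt
  have hr : Tendsto Real.toNNReal (𝓝 (t : ℝ)) (𝓝 t) := by
    have := continuous_real_toNNReal.continuousAt (x := (t : ℝ))
    rwa [ContinuousAt, Real.toNNReal_coe] at this
  have hcl : Tendsto ((↑) : ℝ≥0 → ℝ) (𝓝[<] t) (𝓝[<] (t : ℝ)) :=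
    tendsto_nhdsWithin_of_tendsto_nhds_of_eventually_within _
      (hc.mono_left nhdsWithin_le_nhds) (by
        filter_upwards [self_mem_nhdsWithin] with s hs using NNReal.coe_lt_coe.2 hs)
  have hcr : Tendsto ((↑) : ℝ≥0 → ℝ) (𝓝[>] t) (𝓝[>] (t : ℝ)) :=
    tendsto_nhdsWithin_of_tendsto_nhds_of_eventually_within _
      (hc.mono_left nhdsWithin_le_nhds) (by
        filter_upwards [self_mem_nhdsWithin] with s hs using NNReal.coe_lt_coe.2 hs)
  have hrl : Tendsto Real.toNNReal (𝓝[<] (t : ℝ)) (𝓝[<] t) :=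
    tendsto_nhdsWithin_of_tendsto_nhds_of_eventually_within _
      (hr.mono_left nhdsWithin_le_nhds) (by
        filter_upwards [self_mem_nhdsWithin] with s hs
        exact NNReal.coe_lt_coe.1 (by rw [Real.coe_toNNReal']; exact max_lt hs ht))
  have hrr : Tendsto Real.toNNReal (𝓝[>] (t : ℝ)) (𝓝[>] t) :=
    tendsto_nhdsWithin_of_tendsto_nhds_of_eventually_within _
      (hr.mono_left nhdsWithin_le_nhds) (by
        filter_upwards [self_mem_nhdsWithin] with s hs
        exact Real.lt_toNNReal_iff_coe_lt.2 hs)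
  constructor
  · rintro ⟨-, h1, h2, h3⟩
    exact ⟨by rw [hcoe, h1], hrl.eventually h2, hrr.eventually h3⟩
  · rintro ⟨h1, h2, h3⟩
    refine ⟨ht, by rw [← hcoe, h1], ?_, ?_⟩
    · filter_upwards [hcl.eventually h2] with s hs using by rwa [← hcoe]
    · filter_upwards [hcr.eventually h3] with s hs using by rwa [← hcoe]

/-- The indicator of the event that the path steps over the level `v` between `0` and `δ`. -/
def stepIndicator (v δ : ℝ) : DiffPath → ℝ≥0∞ :=
  Set.indicator {y | y.1 0 ≤ v ∧ v < y.1 δ.toNNReal} 1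

lemma measurable_apply (t : ℝ≥0) : Measurable fun y : DiffPath => y.1 t :=
  (measurable_pi_apply t).comp measurable_subtype_coe

lemma measurableSet_step (v δ : ℝ) :
    MeasurableSet {y : DiffPath | y.1 0 ≤ v ∧ v < y.1 δ.toNNReal} :=
  (measurableSet_le (measurable_apply 0) measurable_const).inter
    (measurableSet_lt measurable_const (measurable_apply _))

lemma measurable_stepIndicator (v δ : ℝ) : Measurable (stepIndicator v δ) :=
  measurable_one.indicator (measurableSet_step v δ)

/-- The dictionary between ergodic averages on path space and the step sets of an individual path.
-/
lemma occupation_stepIndicator (v : ℝ) {δ : ℝ} (hδ : 0 ≤ δ) (a : ℝ≥0) (b : ℝ) (y : DiffPath) :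
    occupation (stepIndicator v δ) b (shift a y) = volume (stepSet y.extend v δ a (a + b)) := by
  have h1 : volume (stepSet y.extend v δ a (a + b)) =
      volume ((fun s : ℝ => s + a) ⁻¹' (stepSet y.extend v δ a (a + b))) :=
    ((measurePreserving_add_right volume (a : ℝ)).measure_preimage
      (measurableSet_stepSet y.continuous_extend v δ a (a + b)).nullMeasurableSet).symm
  have h2 : (fun s : ℝ => s + a) ⁻¹' (stepSet y.extend v δ a (a + b)) =
      {s : ℝ | shift s.toNNReal (shift a y) ∈
        {y : DiffPath | y.1 0 ≤ v ∧ v < y.1 δ.toNNReal}} ∩ Set.Ioo 0 b := by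
    ext s
    simp only [stepSet, Set.mem_preimage, Set.mem_ofPred_eq, Set.mem_Ioo, Set.mem_inter_iff,
      DiffPath.extend]
    constructor
    · rintro ⟨⟨h1, h2⟩, h3, h4⟩
      have hs : 0 ≤ s := by linarith
      refine ⟨⟨?_, ?_⟩, by linarith, by linarith⟩
      · simpa [shift_shift, Real.toNNReal_add hs a.coe_nonneg] using h3
      · rw [Real.toNNReal_add (by positivity) hδ, Real.toNNReal_add hs a.coe_nonneg] at h4
        simpa [add_assoc, add_comm, add_left_comm] using h4
    · rintro ⟨⟨h3, h4⟩, h1, h2⟩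
      refine ⟨⟨by linarith, by linarith⟩, ?_, ?_⟩
      · simpa [shift_shift, Real.toNNReal_add h1.le a.coe_nonneg] using h3
      · rw [Real.toNNReal_add (by positivity) hδ, Real.toNNReal_add h1.le a.coe_nonneg]
        simpa [add_assoc, add_comm, add_left_comm] using h4
  have hmeas : MeasurableSet {s : ℝ | shift s.toNNReal (shift a y) ∈
      {y : DiffPath | y.1 0 ≤ v ∧ v < y.1 δ.toNNReal}} :=
    (measurableSet_step v δ).preimage (by fun_prop)
  rw [h1, h2, occupation]
  have h3 : ∀ s : ℝ, stepIndicator v δ (shift s.toNNReal (shift a y)) =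
      Set.indicator {s : ℝ | shift s.toNNReal (shift a y) ∈
        {y : DiffPath | y.1 0 ≤ v ∧ v < y.1 δ.toNNReal}} 1 s := fun s => rfl
  simp_rw [h3]
  rw [lintegral_indicator_one hmeas, Measure.restrict_congr_set Ioo_ae_eq_Ioc.symm,
    Measure.restrict_apply hmeas]

lemma occupation_stepIndicator_zero (v : ℝ) {δ : ℝ} (hδ : 0 ≤ δ) (b : ℝ) (y : DiffPath) :
    occupation (stepIndicator v δ) b y = volume (stepSet y.extend v δ 0 b) := by
  simpa [shift_zero] using occupation_stepIndicator v hδ 0 b y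

/-- An upper bound for the number of up-crossings of the level `v` in the time interval `(0, 1)`. -/
def crossingBound (v : ℝ) (y : DiffPath) : ℝ≥0∞ :=
  liminf (fun n => (ENNReal.ofReal (mesh n))⁻¹ * occupation (stepIndicator v (mesh n)) 1 y) atTop

lemma measurable_crossingBound (v : ℝ) : Measurable (crossingBound v) :=
  Measurable.liminf fun _ =>
    measurable_const.mul (measurable_occupation (measurable_stepIndicator v _) 1)

/-- Fatou's lemma; by stationarity the mean step measure over a unit window is exactly the
probability of a step. -/
lemma lintegral_crossingBound_le {μ : Measure DiffPath} [IsProbabilityMeasure μ]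
    (hμ : IsErgodicLaw μ) (v : ℝ) {ν : ℝ≥0∞}
    (hν : Tendsto (fun n => (ENNReal.ofReal (mesh n))⁻¹ *
      μ {y : DiffPath | y.1 0 ≤ v ∧ v < y.1 (mesh n).toNNReal}) atTop (𝓝 ν)) :
    ∫⁻ y, crossingBound v y ∂μ ≤ ν := by
  refine (lintegral_liminf_le
    (f := fun n y => (ENNReal.ofReal (mesh n))⁻¹ * occupation (stepIndicator v (mesh n)) 1 y)
    fun n => measurable_const.mul
      (measurable_occupation (measurable_stepIndicator v (mesh n)) 1)).trans ?_
  refine le_of_eq ?_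
  rw [← hν.liminf_eq]
  congr 1
  ext n
  rw [lintegral_const_mul _ (measurable_occupation (measurable_stepIndicator v _) 1),
    lintegral_occupation hμ (measurable_stepIndicator v _), ENNReal.ofReal_one, one_mul,
    stepIndicator, lintegral_indicator_one (measurableSet_step v _)]

/-! ### Counting the up-crossings of a single path. -/

section Pathwise

variable {y : DiffPath} {v : ℝ}

lemma card_le_crossingBound (hnull : volume ({s | y.extend s = v} ∩ Set.Ioi 0) = 0) (a : ℝ≥0)
    (F : Finset ℝ) (hF : ∀ t ∈ F, t ∈ Set.Ioo (a : ℝ) (a + 1))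
    (hup : ∀ t ∈ F, IsRealUpcrossing y.extend v t) :
    (F.card : ℝ≥0∞) ≤ crossingBound v (shift a y) := by
  refine le_liminf_of_le (by isBoundedDefault) ?_
  filter_upwards [tendsto_mesh.eventually
    (eventually_card_mul_le y.continuous_extend hnull a.coe_nonneg F hF hup)] with n hn
  rw [occupation_stepIndicator v (mesh_pos n).le]
  have h0 : ENNReal.ofReal (mesh n) ≠ 0 := by simpa using mesh_pos n
  calc (F.card : ℝ≥0∞)
      = (ENNReal.ofReal (mesh n))⁻¹ * (F.card * ENNReal.ofReal (mesh n)) := by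
        rw [mul_comm (F.card : ℝ≥0∞), ← mul_assoc, ENNReal.inv_mul_cancel h0 (by simp), one_mul]
    _ ≤ _ := mul_le_mul_right hn _

lemma exists_isRealUpcrossing_of_crossingBound_lt_top {a : ℝ≥0}
    (hfin : crossingBound v (shift a y) < ∞) {b : ℝ} (hab : (a : ℝ) < b) (hb : b ≤ a + 1)
    (hya : y.extend a < v) (hyb : v < y.extend b) :
    ∃ t ∈ Set.Ioo (a : ℝ) b, IsRealUpcrossing y.extend v t := by
  obtain ⟨M, hM⟩ := ENNReal.exists_nat_gt hfin.ne
  refine exists_isRealUpcrossing y.continuous_extend M hab hya hyb ?_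
  refine (frequently_lt_of_liminf_lt (by isBoundedDefault) hM).mono fun n hn => ?_
  have h0 : ENNReal.ofReal (mesh n) ≠ 0 := by simpa using mesh_pos n
  rw [occupation_stepIndicator v (mesh_pos n).le] at hn
  calc volume (stepSet y.extend v (mesh n) a b)
      ≤ volume (stepSet y.extend v (mesh n) a (a + 1)) := volume_stepSet_mono _ _ le_rfl hb
    _ = ENNReal.ofReal (mesh n) * ((ENNReal.ofReal (mesh n))⁻¹ *
          volume (stepSet y.extend v (mesh n) a (a + 1))) := by
        rw [← mul_assoc, ENNReal.mul_inv_cancel h0 (by simp), one_mul]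
    _ ≤ ENNReal.ofReal (mesh n) * M := mul_le_mul_right hn.le _
    _ = _ := mul_comm _ _

/-- Slide a unit window: a crossing `t ≥ 1` belongs to `(s, s + 1)` exactly for `s` in `(t - 1, t)`,
a subset of `(0, T]` of measure one, so integrating the window counts over `s` counts it once.
Crossings before time `1` are counted by the window at `0`, whence the first term. -/
lemma card_upcrossings_le (hnull : volume ({s | y.extend s = v} ∩ Set.Ioi 0) = 0) (T : ℝ≥0)
    (F : Finset ℝ≥0) (hF : (F : Set ℝ≥0) ⊆ upcrossings y.1 v T) :
    (F.card : ℝ≥0∞) ≤ crossingBound v y + occupation (crossingBound v) T y := by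
  set G : Finset ℝ := F.map ⟨((↑) : ℝ≥0 → ℝ), NNReal.coe_injective⟩ with hG
  have hGmem : ∀ t ∈ G, 0 < t ∧ t ≤ T ∧ IsRealUpcrossing y.extend v t := by
    intro t ht
    obtain ⟨s, hs, rfl⟩ := Finset.mem_map.1 ht
    obtain ⟨h1, h2⟩ := hF hs
    exact ⟨h2.1, h1, (isUpcrossing_iff y v h2.1).1 h2⟩
  have hcard : F.card = G.card := (Finset.card_map _).symm
  have hwin : ∀ a : ℝ≥0, ((G.filter fun t => t ∈ Set.Ioo (a : ℝ) (a + 1)).card : ℝ≥0∞) ≤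
      crossingBound v (shift a y) := fun a =>
    card_le_crossingBound hnull a _ (fun t ht => (Finset.mem_filter.1 ht).2)
      fun t ht => (hGmem t (Finset.mem_filter.1 ht).1).2.2
  have hsplit : G.card = (G.filter fun t => t < 1).card + (G.filter fun t => ¬ t < 1).card :=
    (Finset.card_filter_add_card_filter_not _).symm
  rw [hcard, hsplit]
  push_cast
  refine add_le_add ?_ ?_
  · have h := hwin 0
    rw [shift_zero] at h
    refine le_trans ?_ h
    refine Nat.cast_le.2 (Finset.card_le_card fun t ht => ?_)
    obtain ⟨ht, h1⟩ := Finset.mem_filter.1 ht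
    exact Finset.mem_filter.2 ⟨ht, by simpa using ⟨(hGmem t ht).1, h1⟩⟩
  · calc ((G.filter fun t => ¬ t < 1).card : ℝ≥0∞)
        = ∑ t ∈ G.filter fun t => ¬ t < 1, volume (Set.Ioo (t - 1) t ∩ Set.Ioc 0 (T : ℝ)) := by
          rw [Finset.card_eq_sum_ones]
          push_cast
          refine Finset.sum_congr rfl fun t ht => ?_
          obtain ⟨ht, h1⟩ := Finset.mem_filter.1 ht
          have h2 := (hGmem t ht).2.1
          rw [Set.inter_eq_left.2]
          · simp
          · exact fun s hs => ⟨by linarith [hs.1], hs.2.le.trans h2⟩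
      _ = ∑ t ∈ G.filter fun t => ¬ t < 1,
            ∫⁻ s in Set.Ioc 0 (T : ℝ), (Set.Ioo (t - 1) t).indicator 1 s := by
          refine Finset.sum_congr rfl fun t _ => ?_
          rw [lintegral_indicator_one measurableSet_Ioo, Measure.restrict_apply measurableSet_Ioo]
      _ = ∫⁻ s in Set.Ioc 0 (T : ℝ), ∑ t ∈ G.filter fun t => ¬ t < 1,
            (Set.Ioo (t - 1) t).indicator 1 s :=
          (lintegral_finsetSum _ fun t _ => measurable_one.indicator measurableSet_Ioo).symm
      _ ≤ occupation (crossingBound v) T y := by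
          refine setLIntegral_mono
            ((measurable_crossingBound v).comp (by fun_prop)) fun s hs => ?_
          refine le_trans ?_ (hwin s.toNNReal)
          rw [Real.coe_toNNReal _ hs.1.le]
          calc ∑ t ∈ G.filter fun t => ¬ t < 1, (Set.Ioo (t - 1) t).indicator (1 : ℝ → ℝ≥0∞) s
              ≤ ∑ t ∈ G, (Set.Ioo (t - 1) t).indicator (1 : ℝ → ℝ≥0∞) s :=
                Finset.sum_le_sum_of_subset (Finset.filter_subset _ _)
            _ = ((G.filter fun t => t ∈ Set.Ioo s (s + 1)).card : ℝ≥0∞) := by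
                rw [Finset.card_filter]
                push_cast
                refine Finset.sum_congr rfl fun t _ => ?_
                simp only [Set.indicator_apply, Set.mem_Ioo, Pi.one_apply, sub_lt_iff_lt_add]
                congr 1
                rw [and_comm]
            _ ≤ _ := le_rfl

/-- Outside two null sets, those of times at the level and of times with infinite `crossingBound`, a
step at `s` yields an up-crossing `t` with `s` in `(t - mesh n, t)`. The `+ 1` pays for steps
starting in the last `mesh n` before `T`, whose crossing may fall after `T`. -/
lemma occupation_stepIndicator_le (hnull : volume ({s | y.extend s = v} ∩ Set.Ioi 0) = 0)
    (hocc : ∀ H : ℝ, occupation (crossingBound v) H y < ∞) (n : ℕ) (T : ℝ≥0)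
    (hfin : (upcrossings y.1 v T).Finite) :
    occupation (stepIndicator v (mesh n)) T y ≤
      ENNReal.ofReal (mesh n) * ((upcrossings y.1 v T).ncard + 1) := by
  rw [occupation_stepIndicator_zero v (mesh_pos n).le]
  have hae : ∀ᵐ s ∂volume.restrict (Set.Ioc 0 (T : ℝ)),
      crossingBound v (shift s.toNNReal y) < ∞ :=
    ae_lt_top ((measurable_crossingBound v).comp (by fun_prop)) (hocc T).ne
  rw [ae_restrict_iff' measurableSet_Ioc] at hae
  set N : Set ℝ := {s | ¬ (s ∈ Set.Ioc 0 (T : ℝ) → crossingBound v (shift s.toNNReal y) < ∞)}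
  have hN : volume N = 0 := hae
  have hsub : stepSet y.extend v (mesh n) 0 T ⊆
      (⋃ t ∈ hfin.toFinset, Set.Ioo ((t : ℝ) - mesh n) t) ∪ Set.Ico (T - mesh n) T ∪
        (({s | y.extend s = v} ∩ Set.Ioi 0) ∪ N) := by
    intro s hs
    obtain ⟨⟨hs0, hsT⟩, hs1, hs2⟩ := hs
    by_cases hsv : y.extend s = v
    · exact Or.inr (Or.inl ⟨hsv, hs0⟩)
    by_cases hsN : s ∈ N
    · exact Or.inr (Or.inr hsN)
    have hcb : crossingBound v (shift s.toNNReal y) < ∞ := not_not.1 hsN ⟨hs0, hsT.le⟩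
    rcases le_or_gt (T - mesh n) s with h | h
    · exact Or.inl (Or.inr ⟨h, hsT⟩)
    left; left
    have hcoe : (s.toNNReal : ℝ) = s := Real.coe_toNNReal _ hs0.le
    obtain ⟨t, ht, htup⟩ := exists_isRealUpcrossing_of_crossingBound_lt_top hcb
      (b := s + mesh n) (by rw [hcoe]; linarith [mesh_pos n])
      (by rw [hcoe]; linarith [mesh_le_one n])
      (by rw [hcoe]; exact lt_of_le_of_ne hs1 hsv) hs2
    rw [hcoe] at ht
    have ht0 : 0 < t := hs0.trans ht.1
    have hcoet : (t.toNNReal : ℝ) = t := Real.coe_toNNReal _ ht0.le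
    refine Set.mem_biUnion (x := t.toNNReal) ?_ ?_
    · have ht0' : 0 < t.toNNReal := Real.toNNReal_pos.2 ht0
      simp only [Finset.mem_coe, Set.Finite.mem_toFinset]
      refine ⟨?_, (isUpcrossing_iff y v ht0').2 (by rwa [hcoet])⟩
      rw [← NNReal.coe_le_coe, hcoet]
      linarith [ht.2]
    · rw [hcoet]
      exact ⟨by linarith [ht.2], ht.1⟩
  calc volume (stepSet y.extend v (mesh n) 0 T)
      ≤ (volume (⋃ t ∈ hfin.toFinset, Set.Ioo ((t : ℝ) - mesh n) t) +
          volume (Set.Ico (T - mesh n) (T : ℝ))) +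
          (volume ({s | y.extend s = v} ∩ Set.Ioi 0) + volume N) :=
        (measure_mono hsub).trans ((measure_union_le _ _).trans
          (add_le_add (measure_union_le _ _) (measure_union_le _ _)))
    _ ≤ ((hfin.toFinset.card : ℝ≥0∞) * ENNReal.ofReal (mesh n) + ENNReal.ofReal (mesh n)) +
          (0 + 0) := by
        rw [hnull, hN]
        refine add_le_add (add_le_add ?_ (by simp)) le_rfl
        refine (measure_biUnion_finset_le _ _).trans ?_
        simp
    _ = _ := by
        rw [Set.ncard_eq_toFinset_card _ hfin]
        ring

end Pathwise

lemma tendsto_toReal_occupation {y : DiffPath} {g : DiffPath → ℝ≥0∞} {m : ℝ≥0∞} (hm : m ≠ ∞)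
    (h : Tendsto (fun H : ℝ => (ENNReal.ofReal H)⁻¹ * occupation g H y) atTop (𝓝 m)) :
    Tendsto (fun H : ℝ => (occupation g H y).toReal / H) atTop (𝓝 m.toReal) := by
  refine ((ENNReal.tendsto_toReal hm).comp h).congr' ?_
  filter_upwards [eventually_gt_atTop 0] with H hH
  simp [ENNReal.toReal_mul, ENNReal.toReal_inv, ENNReal.toReal_ofReal hH.le, div_eq_inv_mul]

lemma ae_volume_level_eq_zero {μ : Measure DiffPath} [IsProbabilityMeasure μ] {v : ℝ}
    (hv : ∀ t, μ {y : DiffPath | y.1 t = v} = 0) :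
    ∀ᵐ y ∂μ, volume ({s | y.extend s = v} ∩ Set.Ioi 0) = 0 := by
  have hmeas : MeasurableSet {p : ℝ × DiffPath | p.2.extend p.1 ≠ v} := by
    have : Measurable fun p : ℝ × DiffPath => p.2.extend p.1 :=
      measurable_eval.comp (f := fun p : ℝ × DiffPath => (p.1.toNNReal, p.2)) (by fun_prop)
    exact (measurableSet_eq_fun this measurable_const).compl
  have h : ∀ᵐ s : ℝ, ∀ᵐ y ∂μ, y.extend s ≠ v := ae_of_all _ fun s => by
    simpa [ae_iff, DiffPath.extend] using hv s.toNNReal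
  filter_upwards [(Measure.ae_ae_comm hmeas).1 h] with y hy
  refine measure_mono_null Set.inter_subset_left ?_
  simpa [ae_iff] using hy

/-- The up-crossing intensity of an ergodic law, as the limiting rate of steps over the level. -/
theorem IsErgodicLaw.hasUpcrossingIntensity {μ : Measure DiffPath} [IsProbabilityMeasure μ]
    (hμ : IsErgodicLaw μ) {v ν : ℝ} (hν0 : 0 ≤ ν)
    (hv : ∀ t, μ {y : DiffPath | y.1 t = v} = 0)
    (hν : Tendsto (fun n => (ENNReal.ofReal (mesh n))⁻¹ *
      μ {y : DiffPath | y.1 0 ≤ v ∧ v < y.1 (mesh n).toNNReal}) atTop (𝓝 (ENNReal.ofReal ν))) :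
    ∀ᵐ y ∂μ, HasUpcrossingIntensity y.1 v ν := by
  have hE := lintegral_crossingBound_le hμ v hν
  have hEt : ∫⁻ y, crossingBound v y ∂μ ≠ ∞ := ne_top_of_le_ne_top (by simp) hE
  have hstep : ∀ᵐ y ∂μ, ∀ n, Tendsto (fun H : ℝ => (ENNReal.ofReal H)⁻¹ *
      occupation (stepIndicator v (mesh n)) H y) atTop
      (𝓝 (μ {y : DiffPath | y.1 0 ≤ v ∧ v < y.1 (mesh n).toNNReal})) :=
    ae_all_iff.2 fun n => by
      have hi : ∫⁻ y, stepIndicator v (mesh n) y ∂μ =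
          μ {y : DiffPath | y.1 0 ≤ v ∧ v < y.1 (mesh n).toNNReal} :=
        lintegral_indicator_one (measurableSet_step v _)
      rw [← hi]
      exact hμ.tendsto_occupation (measurable_stepIndicator v _) (by rw [hi]; exact measure_ne_top _ _)
  filter_upwards [ae_volume_level_eq_zero hv, ae_lt_top (measurable_crossingBound v) hEt,
    hμ.occupation_lt_top (measurable_crossingBound v) hEt,
    hμ.tendsto_occupation (measurable_crossingBound v) hEt, hstep]
    with y hnull hy0 hocc havg hstep
  have hfin : ∀ T : ℝ≥0, (upcrossings y.1 v T).Finite := by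
    intro T
    by_contra hinf
    obtain ⟨N, hN⟩ := ENNReal.exists_nat_gt (ENNReal.add_lt_top.2 ⟨hy0, hocc T⟩).ne
    obtain ⟨F, hF, hFc⟩ := Set.Infinite.exists_subset_card_eq hinf N
    have := card_upcrossings_le hnull T F hF
    rw [hFc] at this
    exact absurd this (not_le.2 hN)
  refine ⟨hfin, tendsto_order.2 ⟨fun a ha => ?_, fun b hb => ?_⟩⟩
  -- Lower bound: `n` is fixed first so that the step probability over `mesh n` exceeds `a`; only
  -- then does `T → ∞`, which also removes the boundary term `1 / T`.
  · have hνreal : Tendsto (fun n => (μ {y : DiffPath | y.1 0 ≤ v ∧ v < y.1 (mesh n).toNNReal}).toReal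
        / mesh n) atTop (𝓝 ν) := by
      have := (ENNReal.tendsto_toReal (by simp)).comp hν
      rw [ENNReal.toReal_ofReal hν0] at this
      refine this.congr fun n => ?_
      simp [ENNReal.toReal_mul, ENNReal.toReal_inv, ENNReal.toReal_ofReal (mesh_pos n).le,
        div_eq_inv_mul]
    obtain ⟨n, hn⟩ := ((tendsto_order.1 hνreal).1 a ha).exists
    have h1 := (tendsto_toReal_occupation (measure_ne_top _ _) (hstep n)).div_const (mesh n)
    have h2 : Tendsto (fun H : ℝ => 1 / H) atTop (𝓝 0) := by
      simpa using tendsto_inv_atTop_zero (𝕜 := ℝ)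
    have h3 := h1.sub h2
    rw [sub_zero] at h3
    have h4 := (NNReal.tendsto_coe_atTop.2 tendsto_id).eventually ((tendsto_order.1 h3).1 a hn)
    filter_upwards [h4, eventually_gt_atTop 0] with T hT hT0
    refine hT.trans_le ?_
    have hT0' : (0 : ℝ) < T := hT0
    have hle := ENNReal.toReal_mono (by finiteness)
      (occupation_stepIndicator_le hnull hocc n T (hfin T))
    rw [ENNReal.toReal_mul, ENNReal.toReal_ofReal (mesh_pos n).le,
      ENNReal.toReal_add (by simp) (by simp)] at hle
    simp only [ENNReal.toReal_natCast, ENNReal.toReal_one] at hle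
    have hm := mesh_pos n
    simp only [id]
    rw [div_right_comm, ← sub_div, div_le_div_iff_of_pos_right hT0', sub_le_iff_le_add,
      div_le_iff₀ hm]
    linarith
  -- Upper bound: the ergodic theorem for the integrable functional `crossingBound`, whose mean is
  -- at most `ν`.
  · have hm : (∫⁻ y, crossingBound v y ∂μ).toReal ≤ ν := ENNReal.toReal_le_of_le_ofReal hν0 hE
    have h1 := tendsto_toReal_occupation hEt havg
    have h2 : Tendsto (fun H : ℝ => (crossingBound v y).toReal / H) atTop (𝓝 0) :=
      tendsto_const_nhds.div_atTop tendsto_id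
    have h3 := h2.add h1
    rw [zero_add] at h3
    have h4 := (NNReal.tendsto_coe_atTop.2 tendsto_id).eventually
      ((tendsto_order.1 h3).2 b (hm.trans_lt hb))
    filter_upwards [h4, eventually_gt_atTop 0] with T hT hT0
    refine lt_of_le_of_lt ?_ hT
    have hT0' : (0 : ℝ) < T := hT0
    have hle := ENNReal.toReal_mono (ENNReal.add_lt_top.2 ⟨hy0, hocc T⟩).ne
      (card_upcrossings_le hnull T (hfin T).toFinset (by simp))
    rw [ENNReal.toReal_add hy0.ne (hocc T).ne] at hle
    rw [← Set.ncard_eq_toFinset_card _ (hfin T)] at hle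
    simp only [ENNReal.toReal_natCast] at hle
    simp only [id]
    rw [← add_div]
    gcongr

/-! ### Deterministic time changes -/

/-- `φ` solves `φ(t) = ∫₀ᵗ k(φ(s)) ds`. -/
def SolvesTimeChange (k : ℝ≥0 → ℝ) (φ : ℝ≥0 → ℝ≥0) : Prop :=
  ∀ t : ℝ≥0, IntervalIntegrable (fun s : ℝ => k (φ s.toNNReal)) volume 0 t ∧
    (φ t : ℝ) = ∫ s in (0 : ℝ)..t, k (φ s.toNNReal)

namespace SolvesTimeChange

variable {k : ℝ≥0 → ℝ} {φ : ℝ≥0 → ℝ≥0}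

lemma map_zero (h : SolvesTimeChange k φ) : φ 0 = 0 := by
  have := (h 0).2
  simpa using this

lemma strictMono (h : SolvesTimeChange k φ) (hk : ∀ s, 0 < k s) : StrictMono φ := by
  intro s t hst
  have hst' : (s : ℝ) < t := hst
  rw [← NNReal.coe_lt_coe, (h s).2, (h t).2, ← sub_pos,
    intervalIntegral.integral_interval_sub_left (h t).1 (h s).1]
  exact intervalIntegral.intervalIntegral_pos_of_pos ((h s).1.symm.trans (h t).1)
    (fun r => hk _) hst'

lemma intervalIntegrable (h : SolvesTimeChange k φ) (a b : ℝ) :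
    IntervalIntegrable (fun s : ℝ => k (φ s.toNNReal)) volume a b := by
  have h0 : ∀ c : ℝ, IntervalIntegrable (fun s : ℝ => k (φ s.toNNReal)) volume 0 c := by
    intro c
    rcases le_total 0 c with hc | hc
    · simpa [Real.coe_toNNReal c hc] using (h c.toNNReal).1
    · refine (intervalIntegrable_const (c := k (φ 0))).congr fun s hs => ?_
      rw [Set.uIoc_of_ge hc] at hs
      simp only [Real.toNNReal_of_nonpos hs.2]
  exact (h0 a).symm.trans (h0 b)

lemma continuous (h : SolvesTimeChange k φ) : Continuous φ := by
  have hc : Continuous fun t : ℝ≥0 => (φ t : ℝ) := by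
    have := (intervalIntegral.continuous_primitive h.intervalIntegrable 0).comp
      NNReal.continuous_coe
    convert this using 1
    ext t
    exact (h t).2
  exact continuous_induced_rng.2 hc

lemma exists_eq (h : SolvesTimeChange k φ) {T a : ℝ≥0} (ha : a ≤ φ T) : ∃ t ≤ T, φ t = a := by
  have hsub := intermediate_value_Icc (zero_le : 0 ≤ T) h.continuous.continuousOn
  obtain ⟨t, ht, rfl⟩ := hsub ⟨by simp [h.map_zero], ha⟩
  exact ⟨t, ht.2, rfl⟩

lemma setLIntegral_speed (h : SolvesTimeChange k φ) (hk : ∀ s, 0 < k s) (T : ℝ≥0) :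
    ∫⁻ s in Set.Ioc 0 (T : ℝ), ENNReal.ofReal (k (φ s.toNNReal)) = (φ T : ℝ≥0∞) := by
  rw [← ofReal_integral_eq_lintegral_ofReal
    ((intervalIntegrable_iff_integrableOn_Ioc_of_le T.coe_nonneg).1 (h T).1)
    (ae_of_all _ fun s => (hk _).le), ← intervalIntegral.integral_of_le T.coe_nonneg, ← (h T).2,
    ENNReal.ofReal_coe_nnreal]

/-- Change of variables along `φ`, which is known only as an indefinite integral, so no pointwise
derivative is used. Measures are compared on half-lines, whose preimages under the increasing `φ`
are initial intervals. -/
lemma map_withDensity (h : SolvesTimeChange k φ) (hk : ∀ s, 0 < k s) (T : ℝ≥0) :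
    ((volume.restrict (Set.Ioc 0 (T : ℝ))).withDensity
      fun s => ENNReal.ofReal (k (φ s.toNNReal))).map (fun s : ℝ => (φ s.toNNReal : ℝ)) =
    volume.restrict (Set.Ioc 0 (φ T : ℝ)) := by
  have hm : Measurable fun s : ℝ => (φ s.toNNReal : ℝ) :=
    (NNReal.continuous_coe.comp (h.continuous.comp continuous_real_toNNReal)).measurable
  have happly : ∀ a : ℝ, ((volume.restrict (Set.Ioc 0 (T : ℝ))).withDensity
      fun s => ENNReal.ofReal (k (φ s.toNNReal))).map (fun s : ℝ => (φ s.toNNReal : ℝ)) (Set.Iic a) =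
      ∫⁻ s in {s : ℝ | (φ s.toNNReal : ℝ) ≤ a} ∩ Set.Ioc 0 (T : ℝ),
        ENNReal.ofReal (k (φ s.toNNReal)) := by
    intro a
    have hset : MeasurableSet {s : ℝ | (φ s.toNNReal : ℝ) ≤ a} :=
      measurableSet_le hm measurable_const
    have hpre : (fun s : ℝ => (φ s.toNNReal : ℝ)) ⁻¹' Set.Iic a =
        {s : ℝ | (φ s.toNNReal : ℝ) ≤ a} := rfl
    rw [Measure.map_apply hm measurableSet_Iic, hpre, withDensity_apply _ hset,
      Measure.restrict_restrict hset]
  have hmono := h.strictMono hk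
  symm
  refine Measure.ext_of_Iic _ _ fun a => ?_
  rw [happly, Measure.restrict_apply measurableSet_Iic]
  rcases lt_or_ge a 0 with ha | ha
  · have h1 : Set.Iic a ∩ Set.Ioc 0 (φ T : ℝ) = ∅ := by
      ext s
      simp only [Set.mem_inter_iff, Set.mem_Iic, Set.mem_Ioc, Set.mem_empty_iff_false, iff_false]
      intro hs; linarith [hs.1, hs.2.1]
    have h2 : {s : ℝ | (φ s.toNNReal : ℝ) ≤ a} ∩ Set.Ioc 0 (T : ℝ) = ∅ := by
      ext s
      simp only [Set.mem_inter_iff, Set.mem_ofPred_eq, Set.mem_empty_iff_false, iff_false]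
      intro hs
      linarith [hs.1, (φ s.toNNReal).coe_nonneg]
    rw [h1, h2]
    simp
  lift a to ℝ≥0 using ha
  -- The endpoint of the preimage; the minimum with `φ T` keeps it in `[0, T]`.
  obtain ⟨t, htT, ht⟩ := h.exists_eq (T := T) (a := min a (φ T)) (min_le_right _ _)
  have h1 : Set.Iic (a : ℝ) ∩ Set.Ioc 0 (φ T : ℝ) = Set.Ioc 0 (φ t : ℝ) := by
    rw [ht]
    ext s
    simp only [Set.mem_inter_iff, Set.mem_Iic, Set.mem_Ioc, NNReal.coe_min, le_min_iff]
    tauto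
  have h2 : {s : ℝ | (φ s.toNNReal : ℝ) ≤ a} ∩ Set.Ioc 0 (T : ℝ) = Set.Ioc 0 (t : ℝ) := by
    ext s
    simp only [Set.mem_inter_iff, Set.mem_ofPred_eq, Set.mem_Ioc, NNReal.coe_le_coe]
    constructor
    · rintro ⟨h1, h2, h3⟩
      refine ⟨h2, ?_⟩
      rw [← Real.toNNReal_le_iff_le_coe, ← hmono.le_iff_le, ht]
      exact le_min h1 (hmono.monotone (Real.toNNReal_le_iff_le_coe.2 h3))
    · rintro ⟨h1, h2⟩
      have h4 := hmono.monotone (Real.toNNReal_le_iff_le_coe.2 h2)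
      rw [ht] at h4
      exact ⟨h4.trans (min_le_left _ _), h1, h2.trans (NNReal.coe_le_coe.2 htT)⟩
  rw [h1, h2, h.setLIntegral_speed hk]
  simp

/-- The inverse time change: `∫₀^{φ(T)} 1 / k = T`. -/
lemma setLIntegral_inv (h : SolvesTimeChange k φ) (hk : ∀ s, 0 < k s) (hkm : Measurable k)
    (T : ℝ≥0) :
    ∫⁻ s in Set.Ioc 0 (φ T : ℝ), ENNReal.ofReal (1 / k s.toNNReal) = (T : ℝ≥0∞) := by
  have hφm : Measurable φ := h.continuous.measurable
  rw [← h.map_withDensity hk, lintegral_map (by fun_prop) (by fun_prop),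
    lintegral_withDensity_eq_lintegral_mul _ (by fun_prop) (by fun_prop)]
  have : ∀ s : ℝ, ((fun s : ℝ => ENNReal.ofReal (k (φ s.toNNReal))) *
      fun s : ℝ => ENNReal.ofReal (1 / k (φ s.toNNReal : ℝ).toNNReal)) s = 1 := fun s => by
    have := hk (φ s.toNNReal)
    rw [Pi.mul_apply, Real.toNNReal_coe, ← ENNReal.ofReal_mul this.le, mul_one_div,
      div_self this.ne', ENNReal.ofReal_one]
  simp_rw [this]
  simp

/-- If `φ` stayed below `b`, then `T = ∫₀^{φ(T)} 1/k` would be at most the finite integral of `1/k`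
over `(0, b]` for every `T`. -/
lemma tendsto_atTop (h : SolvesTimeChange k φ) (hk : ∀ s, 0 < k s) (hkm : Measurable k)
    (hfin : ∀ H : ℝ, ∫⁻ s in Set.Ioc 0 H, ENNReal.ofReal (1 / k s.toNNReal) < ∞) :
    Tendsto φ atTop atTop := by
  refine tendsto_atTop_atTop_of_monotone (h.strictMono hk).monotone fun b => ?_
  by_contra hcon
  push Not at hcon
  obtain ⟨n, hn⟩ := ENNReal.exists_nat_gt (hfin b).ne
  have h1 := h.setLIntegral_inv hk hkm n
  have h2 : ∫⁻ s in Set.Ioc 0 (φ n : ℝ), ENNReal.ofReal (1 / k s.toNNReal) ≤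
      ∫⁻ s in Set.Ioc 0 (b : ℝ), ENNReal.ofReal (1 / k s.toNNReal) :=
    lintegral_mono_set (Set.Ioc_subset_Ioc_right (NNReal.coe_le_coe.2 (hcon n).le))
  rw [h1] at h2
  exact absurd h2 (not_le.2 (by simpa using hn))

lemma surjective (h : SolvesTimeChange k φ) (hlim : Tendsto φ atTop atTop) :
    Function.Surjective φ := by
  intro a
  obtain ⟨T, hT⟩ := (hlim.eventually_ge_atTop a).exists
  obtain ⟨t, -, ht⟩ := h.exists_eq hT
  exact ⟨t, ht⟩

/-- At `H = φ T` the average of `1/k` is `T / φ T`. -/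
lemma tendsto_div (h : SolvesTimeChange k φ) (hk : ∀ s, 0 < k s) (hkm : Measurable k) {q : ℝ}
    (hq : 0 < q) (hlim : Tendsto φ atTop atTop)
    (havg : Tendsto (fun H : ℝ => (ENNReal.ofReal H)⁻¹ *
      ∫⁻ s in Set.Ioc 0 H, ENNReal.ofReal (1 / k s.toNNReal)) atTop (𝓝 (ENNReal.ofReal q))) :
    Tendsto (fun T : ℝ≥0 => (φ T : ℝ) / T) atTop (𝓝 (1 / q)) := by
  have h1 := (ENNReal.tendsto_toReal (by simp)).comp
    (havg.comp (NNReal.tendsto_coe_atTop.2 hlim))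
  rw [ENNReal.toReal_ofReal hq.le] at h1
  have h2 := h1.inv₀ hq.ne'
  rw [one_div]
  refine h2.congr fun T => ?_
  simp only [Function.comp_apply]
  rw [h.setLIntegral_inv hk hkm]
  simp [ENNReal.toReal_mul, ENNReal.toReal_inv, div_eq_mul_inv, mul_comm]

end SolvesTimeChange

lemma isUpcrossing_comp_orderIso (e : ℝ≥0 ≃o ℝ≥0) (x : ℝ≥0 → ℝ) (v : ℝ) (t : ℝ≥0) :
    IsUpcrossing (fun s => x (e s)) v t ↔ IsUpcrossing x v (e t) := by
  have hl : map e (𝓝[<] t) = 𝓝[<] (e t) := by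
    have := e.toHomeomorph.isEmbedding.map_nhdsWithin_eq (Set.Iio t) t
    simpa using this
  have hr : map e (𝓝[>] t) = 𝓝[>] (e t) := by
    have := e.toHomeomorph.isEmbedding.map_nhdsWithin_eq (Set.Ioi t) t
    simpa using this
  have h0 : 0 < e t ↔ 0 < t := by
    have : e 0 = 0 := e.map_bot
    rw [← e.lt_iff_lt (x := 0) (y := t), this]
  simp only [IsUpcrossing, h0, ← hl, ← hr, eventually_map]

lemma image_upcrossings_comp_orderIso (e : ℝ≥0 ≃o ℝ≥0) (x : ℝ≥0 → ℝ) (v : ℝ) (T : ℝ≥0) :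
    e '' upcrossings (fun s => x (e s)) v T = upcrossings x v (e T) := by
  ext t
  constructor
  · rintro ⟨s, ⟨hs1, hs2⟩, rfl⟩
    exact ⟨e.monotone hs1, (isUpcrossing_comp_orderIso e x v s).1 hs2⟩
  · rintro ⟨h1, h2⟩
    refine ⟨e.symm t, ⟨by simpa using e.symm.monotone h1, ?_⟩, e.apply_symm_apply t⟩
    rw [isUpcrossing_comp_orderIso]
    simpa using h2

/-- The effect of a time change on the up-crossing intensity. -/
theorem HasUpcrossingIntensity.comp_timeChange {x : ℝ≥0 → ℝ} {v ν q : ℝ}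
    (hx : HasUpcrossingIntensity x v ν) {k : ℝ≥0 → ℝ} {φ : ℝ≥0 → ℝ≥0} (h : SolvesTimeChange k φ)
    (hk : ∀ s, 0 < k s) (hkm : Measurable k) (hq : 0 < q)
    (hfin : ∀ H : ℝ, ∫⁻ s in Set.Ioc 0 H, ENNReal.ofReal (1 / k s.toNNReal) < ∞)
    (havg : Tendsto (fun H : ℝ => (ENNReal.ofReal H)⁻¹ *
      ∫⁻ s in Set.Ioc 0 H, ENNReal.ofReal (1 / k s.toNNReal)) atTop (𝓝 (ENNReal.ofReal q))) :
    HasUpcrossingIntensity (fun t => x (φ t)) v (1 / q * ν) := by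
  have hlim := h.tendsto_atTop hk hkm hfin
  have hmono := h.strictMono hk
  set e : ℝ≥0 ≃o ℝ≥0 := hmono.orderIsoOfSurjective φ (h.surjective hlim) with he
  have hφ : ∀ t, φ t = e t := fun t => rfl
  have himage : ∀ T, e '' upcrossings (fun t => x (φ t)) v T = upcrossings x v (φ T) :=
    image_upcrossings_comp_orderIso e x v
  refine ⟨fun T => ?_, ?_⟩
  · refine Set.Finite.of_finite_image ?_ e.injective.injOn
    rw [himage]
    exact hx.1 _
  -- The count over `T` factors as `φ T / T` times the count for `x` up to `φ T` over `φ T`.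
  · have h1 := (h.tendsto_div hk hkm hq hlim havg).mul (hx.2.comp hlim)
    refine h1.congr' ?_
    filter_upwards [hlim.eventually_gt_atTop 0] with T hT
    have hT' : (φ T : ℝ) ≠ 0 := (NNReal.coe_pos.2 hT).ne'
    simp only [Function.comp_apply]
    rw [← himage T, Set.ncard_image_of_injective _ e.injective]
    field_simp

/-! ### Gaussian computations -/

section Gaussian

variable {Ω : Type*} [MeasurableSpace Ω] {P : Measure Ω} [IsProbabilityMeasure P]

lemma tendsto_charFun_map {X : ℕ → Ω → ℝ} {L : Ω → ℝ} (hX : ∀ n, AEMeasurable (X n) P)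
    (hlim : ∀ᵐ ω ∂P, Tendsto (fun n => X n ω) atTop (𝓝 (L ω))) (t : ℝ) :
    Tendsto (fun n => charFun (P.map (X n)) t) atTop (𝓝 (charFun (P.map L) t)) := by
  have hL : AEMeasurable L P := aemeasurable_of_tendsto_metrizable_ae' hX hlim
  have hform : ∀ Z : Ω → ℝ, AEMeasurable Z P →
      charFun (P.map Z) t = ∫ ω, Complex.exp (t * Z ω * Complex.I) ∂P := fun Z hZ => by
    rw [charFun_apply_real, integral_map hZ (by fun_prop)]
  rw [hform L hL]
  simp_rw [fun n => hform (X n) (hX n)]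
  refine tendsto_integral_of_dominated_convergence (fun _ => 1) (fun n => ?_)
    (integrable_const _) (fun n => ae_of_all _ fun ω => ?_) ?_
  · have := hX n
    exact AEMeasurable.aestronglyMeasurable (by fun_prop)
  · rw [← Complex.ofReal_mul, Complex.norm_exp_ofReal_mul_I]
  · filter_upwards [hlim] with ω hω
    refine (Complex.continuous_exp.tendsto _).comp ?_
    refine Tendsto.mul_const _ (Tendsto.const_mul _ ?_)
    exact (Complex.continuous_ofReal.tendsto _).comp hω

/-- If centered Gaussian variables converge almost surely, their variances converge to that of
the limit. -/
lemma tendsto_variance_of_ae_tendsto {X : ℕ → Ω → ℝ} {L : Ω → ℝ}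
    (hX : ∀ n, HasGaussianLaw (X n) P) (hmean : ∀ n, ∫ ω, X n ω ∂P = 0)
    (hlim : ∀ᵐ ω ∂P, Tendsto (fun n => X n ω) atTop (𝓝 (L ω))) :
    Tendsto (fun n => variance (X n) P) atTop (𝓝 (variance L P)) := by
  have hXm : ∀ n, AEMeasurable (X n) P := fun n => (hX n).aemeasurable
  have hL : AEMeasurable L P := aemeasurable_of_tendsto_metrizable_ae' hXm hlim
  have : IsProbabilityMeasure (P.map L) := Measure.isProbabilityMeasure_map hL
  have hchar : ∀ n t, charFun (P.map (X n)) t =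
      ((Real.exp (-(variance (X n) P * t ^ 2 / 2)) : ℝ) : ℂ) := fun n t => by
    rw [(hX n).map_eq_gaussianReal, charFun_gaussianReal, hmean,
      Real.coe_toNNReal _ (variance_nonneg _ _)]
    push_cast
    congr 1
    ring
  have hreal : ∀ t, Tendsto (fun n => Real.exp (-(variance (X n) P * t ^ 2 / 2))) atTop
      (𝓝 (charFun (P.map L) t).re) := fun t => by
    have := (Complex.continuous_re.tendsto _).comp (tendsto_charFun_map hXm hlim t)
    refine this.congr fun n => ?_
    simp only [Function.comp_apply, hchar, Complex.ofReal_re]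
  have him : ∀ t, (charFun (P.map L) t).im = 0 := fun t => by
    have := (Complex.continuous_im.tendsto _).comp (tendsto_charFun_map hXm hlim t)
    refine tendsto_nhds_unique this ?_
    refine tendsto_const_nhds.congr fun n => ?_
    simp only [Function.comp_apply, hchar, Complex.ofReal_im]
  -- The limiting characteristic function is `1` at `0`, hence positive at some `t ≠ 0`. Taking
  -- logarithms there gives convergence of the variances without any uniform integrability.
  obtain ⟨t, ht, hpos⟩ : ∃ t : ℝ, t ≠ 0 ∧ 0 < (charFun (P.map L) t).re := by
    have hc : Continuous fun t : ℝ => (charFun (P.map L) t).re :=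
      Complex.continuous_re.comp continuous_charFun
    have h0 : (0 : ℝ) < (charFun (P.map L) (0 : ℝ)).re := by simp [charFun_zero]
    have hev : ∀ᶠ t in 𝓝 (0 : ℝ), 0 < (charFun (P.map L) t).re :=
      hc.continuousAt.eventually_const_lt h0
    obtain ⟨t, h1, h2⟩ := ((hev.filter_mono nhdsWithin_le_nhds).and
      (self_mem_nhdsWithin (a := (0 : ℝ)) (s := {0}ᶜ))).exists
    exact ⟨t, h2, h1⟩
  have hvar : Tendsto (fun n => variance (X n) P) atTop
      (𝓝 (-(2 / t ^ 2) * Real.log (charFun (P.map L) t).re)) := by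
    have := ((hreal t).log hpos.ne').const_mul (-(2 / t ^ 2))
    refine this.congr fun n => ?_
    rw [Real.log_exp]
    field_simp
  set s := -(2 / t ^ 2) * Real.log (charFun (P.map L) t).re
  have hs : 0 ≤ s := ge_of_tendsto' hvar fun n => variance_nonneg _ _
  -- Convergence to `s` alone does not identify the variance of `L`; the law of `L` is therefore
  -- determined from its characteristic function.
  have hlaw : P.map L = gaussianReal 0 s.toNNReal := by
    refine Measure.ext_of_charFun (funext fun r => ?_)
    have h1 : Tendsto (fun n => Real.exp (-(variance (X n) P * r ^ 2 / 2))) atTop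
        (𝓝 (Real.exp (-(s * r ^ 2 / 2)))) :=
      (Real.continuous_exp.tendsto _).comp ((hvar.mul_const _).div_const _).neg
    have h2 := tendsto_nhds_unique (hreal r) h1
    rw [charFun_gaussianReal, Real.coe_toNNReal _ hs]
    have h3 : charFun (P.map L) r = ((Real.exp (-(s * r ^ 2 / 2)) : ℝ) : ℂ) :=
      Complex.ext (by simpa only [Complex.ofReal_re] using h2)
        (by simpa only [Complex.ofReal_im] using him r)
    rw [h3]
    push_cast
    congr 1
    ring
  have hvL : variance L P = s := by
    have := variance_map (X := id) (Y := L) (μ := P) aemeasurable_id hL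
    rw [hlaw, variance_id_gaussianReal, Real.coe_toNNReal _ hs] at this
    exact this.symm
  rwa [hvL]

/-- Scaling a standard normal variable also covers the degenerate case `a = 0`, where there is no
density. -/
lemma gaussianReal_eq_map_stdNormal {a : ℝ} (ha : 0 ≤ a) :
    gaussianReal 0 a.toNNReal = (gaussianReal 0 1).map (fun z => √a * z) := by
  rw [gaussianReal_map_const_mul, mul_zero, mul_one]
  congr 1
  ext
  simp [ha, Real.sq_sqrt ha]

/-- The law of the midpoint and the slope of a centered Gaussian pair with equal variances. -/
lemma map_midpoint_slope {U V : Ω → ℝ} (hUV : HasGaussianLaw (fun ω => (U ω, V ω)) P)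
    (hU : ∫ ω, U ω ∂P = 0) (hV : ∫ ω, V ω ∂P = 0) (hvar : variance U P = variance V P) (δ : ℝ) :
    P.map (fun ω => (2⁻¹ * (U ω + V ω), δ⁻¹ * (V ω - U ω))) =
      stdNormal2.map (fun p => (√(variance (fun ω => 2⁻¹ * (U ω + V ω)) P) * p.1,
        √(variance (fun ω => δ⁻¹ * (V ω - U ω)) P) * p.2)) := by
  have hU2 : MemLp U 2 P := hUV.fst.memLp_two
  have hV2 : MemLp V 2 P := hUV.snd.memLp_two
  have hjoint : HasGaussianLaw (fun ω => (2⁻¹ * (U ω + V ω), δ⁻¹ * (V ω - U ω))) P := by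
    have := hUV.map_fun (((2⁻¹ : ℝ) • (ContinuousLinearMap.fst ℝ ℝ ℝ +
      ContinuousLinearMap.snd ℝ ℝ ℝ)).prod
      (δ⁻¹ • (ContinuousLinearMap.snd ℝ ℝ ℝ - ContinuousLinearMap.fst ℝ ℝ ℝ)))
    simpa [mul_add] using this
  -- The covariance of `U + V` and `V - U` is `var V - var U`, which vanishes; joint Gaussianity
  -- then gives independence.
  have hcov : covariance (fun ω => 2⁻¹ * (U ω + V ω)) (fun ω => δ⁻¹ * (V ω - U ω)) P = 0 := by
    rw [covariance_const_mul_left, covariance_const_mul_right]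
    have : covariance (fun ω => U ω + V ω) (fun ω => V ω - U ω) P = 0 := by
      have h := covariance_add_left hU2 hV2 (hV2.sub hU2)
      have h1 := covariance_sub_right hU2 hV2 hU2
      have h2 := covariance_sub_right hV2 hV2 hU2
      rw [h1, h2, covariance_self hU2.aemeasurable, covariance_self hV2.aemeasurable,
        covariance_comm V U, hvar] at h
      have h' : covariance (fun ω => U ω + V ω) (fun ω => V ω - U ω) P =
        covariance (U + V) (V - U) P := rfl
      rw [h', h]
      ring
    rw [this]
    ring
  have hind := hjoint.indepFun_of_covariance_eq_zero hcov
  have hm1 : ∫ ω, 2⁻¹ * (U ω + V ω) ∂P = 0 := by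
    rw [integral_const_mul, integral_add (hU2.integrable (by norm_num))
      (hV2.integrable (by norm_num)), hU, hV]
    simp
  have hm2 : ∫ ω, δ⁻¹ * (V ω - U ω) ∂P = 0 := by
    rw [integral_const_mul, integral_sub (hV2.integrable (by norm_num))
      (hU2.integrable (by norm_num)), hU, hV]
    simp
  rw [(indepFun_iff_map_prod_eq_prod_map_map hjoint.fst.aemeasurable hjoint.snd.aemeasurable).1 hind,
    hjoint.fst.map_eq_gaussianReal, hjoint.snd.map_eq_gaussianReal, hm1, hm2,
    gaussianReal_eq_map_stdNormal (variance_nonneg _ _),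
    gaussianReal_eq_map_stdNormal (variance_nonneg _ _), Measure.map_prod_map _ _ (by fun_prop)
    (by fun_prop)]
  rfl

instance : IsProbabilityMeasure stdNormal2 := by unfold stdNormal2; infer_instance

/-- Laws of almost surely convergent pairs that are scalings of a standard normal vector. -/
lemma map_eq_stdNormal2_of_tendsto {W : ℕ → Ω → ℝ × ℝ} {L : Ω → ℝ × ℝ} {α β : ℕ → ℝ}
    (hW : ∀ n, AEMeasurable (W n) P)
    (hlim : ∀ᵐ ω ∂P, Tendsto (fun n => W n ω) atTop (𝓝 (L ω)))
    (hα : Tendsto α atTop (𝓝 1)) (hβ : Tendsto β atTop (𝓝 1))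
    (hlaw : ∀ n, P.map (W n) = stdNormal2.map (fun p => (α n * p.1, β n * p.2))) :
    P.map L = stdNormal2 := by
  have hL : AEMeasurable L P := aemeasurable_of_tendsto_metrizable_ae' hW hlim
  have : IsProbabilityMeasure (P.map L) := Measure.isProbabilityMeasure_map hL
  refine ext_of_forall_integral_eq_of_IsFiniteMeasure fun F => ?_
  have h1 : Tendsto (fun n => ∫ ω, F (W n ω) ∂P) atTop (𝓝 (∫ ω, F (L ω) ∂P)) := by
    refine tendsto_integral_of_dominated_convergence (fun _ => ‖F‖) (fun n => ?_)
      (integrable_const _) (fun n => ae_of_all _ fun ω => F.norm_coe_le_norm _) ?_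
    · exact (F.continuous.measurable.comp_aemeasurable (hW n)).aestronglyMeasurable
    · filter_upwards [hlim] with ω hω using (F.continuous.tendsto _).comp hω
  have h2 : Tendsto (fun n => ∫ p, F (α n * p.1, β n * p.2) ∂stdNormal2) atTop
      (𝓝 (∫ p, F p ∂stdNormal2)) := by
    refine tendsto_integral_of_dominated_convergence (fun _ => ‖F‖) (fun n => ?_)
      (integrable_const _) (fun n => ae_of_all _ fun ω => F.norm_coe_le_norm _)
      (ae_of_all _ fun p => ?_)
    · exact (F.continuous.measurable.comp (by fun_prop)).aestronglyMeasurable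
    · have h : Tendsto (fun n => (α n * p.1, β n * p.2)) atTop (𝓝 (1 * p.1, 1 * p.2)) :=
        (hα.mul_const _).prodMk_nhds (hβ.mul_const _)
      rw [one_mul, one_mul] at h
      exact (F.continuous.tendsto p).comp h
  rw [integral_map hL F.continuous.measurable.aestronglyMeasurable]
  refine tendsto_nhds_unique h1 (h2.congr fun n => ?_)
  rw [← integral_map (hW n) F.continuous.measurable.aestronglyMeasurable, hlaw n,
    integral_map (by fun_prop) F.continuous.measurable.aestronglyMeasurable]

end Gaussian

/-! ### The rate of steps over a level for independent normal midpoint and slope. -/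

section Rice

lemma gaussianPDFReal_std (x : ℝ) :
    gaussianPDFReal 0 1 x = (√(2 * Real.pi))⁻¹ * Real.exp (-x ^ 2 / 2) := by
  simp [gaussianPDFReal]

lemma continuous_gaussianPDFReal_std : Continuous (gaussianPDFReal 0 1) := by
  rw [gaussianPDFReal_def]
  fun_prop

lemma gaussianPDFReal_std_le_one (s : ℝ) : gaussianPDFReal 0 1 s ≤ 1 := by
  have h1 : 1 ≤ √(2 * Real.pi * ((1 : ℝ≥0) : ℝ)) := by
    rw [Real.one_le_sqrt]
    simp only [NNReal.coe_one]
    linarith [Real.pi_gt_three]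
  rw [gaussianPDFReal]
  refine mul_le_one₀ (inv_le_one_of_one_le₀ h1) (Real.exp_pos _).le ?_
  rw [Real.exp_le_one_iff]
  refine div_nonpos_of_nonpos_of_nonneg ?_ (by positivity)
  simp only [sub_zero, Left.neg_nonpos_iff]
  positivity

/-- The average of the standard normal density over the interval of length `|r|` around `c`. -/
def densityAverage (c r : ℝ) : ℝ := ∫ τ in (-(1 / 2) : ℝ)..(1 / 2), gaussianPDFReal 0 1 (c + r * τ)

lemma densityAverage_nonneg (c r : ℝ) : 0 ≤ densityAverage c r :=
  intervalIntegral.integral_nonneg (by norm_num) fun _ _ => gaussianPDFReal_nonneg _ _ _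

lemma densityAverage_le_one (c r : ℝ) : densityAverage c r ≤ 1 := by
  have := intervalIntegral.norm_integral_le_of_norm_le_const (a := (-(1 / 2) : ℝ)) (b := 1 / 2)
    (f := fun τ => gaussianPDFReal 0 1 (c + r * τ)) (C := 1) fun τ _ => by
      rw [Real.norm_of_nonneg (gaussianPDFReal_nonneg _ _ _)]
      exact gaussianPDFReal_std_le_one _
  norm_num at this
  exact (le_abs_self _).trans this

lemma tendsto_densityAverage {c r : ℕ → ℝ} {v : ℝ} (hc : Tendsto c atTop (𝓝 v))
    (hr : Tendsto r atTop (𝓝 0)) :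
    Tendsto (fun n => densityAverage (c n) (r n)) atTop (𝓝 (gaussianPDFReal 0 1 v)) := by
  have h : Tendsto (fun n => densityAverage (c n) (r n)) atTop
      (𝓝 (∫ _ in (-(1 / 2) : ℝ)..(1 / 2), gaussianPDFReal 0 1 v)) := by
    refine intervalIntegral.tendsto_integral_filter_of_dominated_convergence (fun _ => 1)
      (Eventually.of_forall fun n => ?_) (Eventually.of_forall fun n => ae_of_all _ fun τ _ => ?_)
      intervalIntegrable_const (ae_of_all _ fun τ _ => ?_)
    · exact (continuous_gaussianPDFReal_std.comp (by fun_prop)).aestronglyMeasurable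
    · rw [Real.norm_of_nonneg (gaussianPDFReal_nonneg _ _ _)]
      exact gaussianPDFReal_std_le_one _
    · have h : Tendsto (fun n => c n + r n * τ) atTop (𝓝 (v + 0 * τ)) := hc.add (hr.mul_const _)
      rw [zero_mul, add_zero] at h
      exact (continuous_gaussianPDFReal_std.tendsto v).comp h
  rw [intervalIntegral.integral_const] at h
  norm_num at h
  exact h

/-- Isolates the factor `r`, which will absorb the division by the step length. For `r < 0` the
interval is empty and `ENNReal.ofReal` vanishes: this is where the positive part of the slope comes
from. -/
lemma gaussianReal_Ioc (c r : ℝ) :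
    gaussianReal 0 1 (Set.Ioc (c - r / 2) (c + r / 2)) =
      ENNReal.ofReal (r * densityAverage c r) := by
  rcases le_or_gt 0 r with hr | hr
  · rw [gaussianReal_apply_eq_integral _ one_ne_zero,
      ← intervalIntegral.integral_of_le (by linarith), densityAverage,
      intervalIntegral.mul_integral_comp_add_mul]
    congr 2 <;> ring
  · rw [Set.Ioc_eq_empty (by linarith), measure_empty, eq_comm, ENNReal.ofReal_eq_zero]
    exact mul_nonpos_of_nonpos_of_nonneg hr.le (densityAverage_nonneg _ _)

lemma measurable_densityAverage (c : ℝ) : Measurable (densityAverage c) := by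
  refine Continuous.measurable ?_
  unfold densityAverage
  refine intervalIntegral.continuous_parametric_intervalIntegral_of_continuous' ?_ _ _
  exact continuous_gaussianPDFReal_std.comp (by fun_prop)

/-- The mean of the positive part, found from the antiderivative `-p` of `x * p x`, where `p` is the
standard normal density. -/
lemma lintegral_ofReal_gaussianReal :
    ∫⁻ z, ENNReal.ofReal z ∂gaussianReal 0 1 = ENNReal.ofReal (√(2 * Real.pi))⁻¹ := by
  have hder : ∀ x ∈ Set.Ioi (0 : ℝ), HasDerivAt (fun x : ℝ => -gaussianPDFReal 0 1 x)
      (gaussianPDFReal 0 1 x * x) x := fun x _ => by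
    have h : HasDerivAt (fun x : ℝ => -x ^ 2 / 2) (-x) x := by
      refine ((hasDerivAt_pow 2 x).neg.div_const 2).congr_deriv ?_
      ring
    simp_rw [gaussianPDFReal_std]
    refine (h.exp.const_mul (√(2 * Real.pi))⁻¹).neg.congr_deriv ?_
    ring
  have hnonneg : ∀ x ∈ Set.Ioi (0 : ℝ), 0 ≤ gaussianPDFReal 0 1 x * x := fun x hx =>
    mul_nonneg (gaussianPDFReal_nonneg _ _ _) (le_of_lt hx)
  have hlim : Tendsto (fun x : ℝ => -gaussianPDFReal 0 1 x) atTop (𝓝 0) := by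
    have h1 : Tendsto (fun x : ℝ => Real.exp (-x ^ 2 / 2)) atTop (𝓝 0) := by
      refine Real.tendsto_exp_atBot.comp ?_
      have : Tendsto (fun x : ℝ => x ^ 2 / 2) atTop atTop :=
        (tendsto_pow_atTop two_ne_zero).atTop_div_const (by norm_num)
      refine (tendsto_neg_atTop_atBot.comp this).congr fun x => ?_
      simp [neg_div]
    have h2 := (h1.const_mul (√(2 * Real.pi))⁻¹).neg
    simpa [gaussianPDFReal_std] using h2
  have hcont : ContinuousWithinAt (fun x : ℝ => -gaussianPDFReal 0 1 x) (Set.Ici 0) 0 :=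
    continuous_gaussianPDFReal_std.neg.continuousWithinAt
  have hint := integrableOn_Ioi_deriv_of_nonneg hcont hder hnonneg hlim
  have hval := integral_Ioi_of_hasDerivAt_of_nonneg hcont hder hnonneg hlim
  rw [gaussianReal_of_var_ne_zero _ one_ne_zero,
    lintegral_withDensity_eq_lintegral_mul _ (measurable_gaussianPDF _ _) (by fun_prop)]
  have hpt : ∀ z : ℝ, (gaussianPDF 0 1 * fun z => ENNReal.ofReal z) z =
      (Set.Ioi (0 : ℝ)).indicator (fun z => ENNReal.ofReal (gaussianPDFReal 0 1 z * z)) z := by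
    intro z
    rw [Pi.mul_apply]
    by_cases hz : 0 < z
    · rw [Set.indicator_of_mem (Set.mem_Ioi.2 hz), gaussianPDF,
        ENNReal.ofReal_mul (gaussianPDFReal_nonneg _ _ _)]
    · rw [Set.indicator_of_notMem (by simpa using hz), ENNReal.ofReal_of_nonpos (not_lt.1 hz),
        mul_zero]
  simp_rw [hpt]
  rw [lintegral_indicator measurableSet_Ioi, ← ofReal_integral_eq_lintegral_ofReal hint
    ((ae_restrict_iff' measurableSet_Ioi).2 (ae_of_all _ hnonneg)), hval]
  simp [gaussianPDFReal]

/-- The rate at which a nearly standard normal midpoint and slope step over a level. -/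
lemma tendsto_stdNormal2_step {α β : ℕ → ℝ} (hα : Tendsto α atTop (𝓝 1))
    (hβ : Tendsto β atTop (𝓝 1)) (v : ℝ) :
    Tendsto (fun n => (ENNReal.ofReal (mesh n))⁻¹ *
      stdNormal2 {p | α n * p.1 - mesh n / 2 * (β n * p.2) ≤ v ∧
        v < α n * p.1 + mesh n / 2 * (β n * p.2)}) atTop
      (𝓝 (ENNReal.ofReal (1 / (2 * Real.pi) * Real.exp (-v ^ 2 / 2)))) := by
  set g := gaussianPDFReal 0 1 v with hg
  have hmesh : Tendsto mesh atTop (𝓝 0) := tendsto_mesh.mono_right nhdsWithin_le_nhds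
  have hβα : Tendsto (fun n => β n / α n) atTop (𝓝 1) := by
    have h := hβ.div hα one_ne_zero
    rwa [div_one] at h
  have hc : Tendsto (fun n => v / α n) atTop (𝓝 v) := by
    have h := (tendsto_const_nhds (x := v)).div hα one_ne_zero
    rwa [div_one] at h
  have hkey : Tendsto (fun n => ∫⁻ z, ENNReal.ofReal
      (β n / α n * z * densityAverage (v / α n) (mesh n * (β n / α n) * z)) ∂gaussianReal 0 1) atTop
      (𝓝 (∫⁻ z, ENNReal.ofReal (1 * z * g) ∂gaussianReal 0 1)) := by
    -- The domination holds once `β n / α n < 2`, since the averaged density is at most `1`.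
    refine tendsto_lintegral_filter_of_dominated_convergence (fun z => ENNReal.ofReal (2 * |z|))
      (Eventually.of_forall fun n => ?_) ?_ ?_ (ae_of_all _ fun z => ?_)
    · have := measurable_densityAverage (v / α n)
      fun_prop
    · filter_upwards [hβα.eventually_lt_const (show (1 : ℝ) < 2 by norm_num),
        hβα.eventually_const_lt (show (0 : ℝ) < 1 by norm_num)] with n h1 h2
      refine ae_of_all _ fun z => ENNReal.ofReal_le_ofReal ?_
      refine (le_abs_self _).trans ?_
      rw [abs_mul, abs_mul, abs_of_pos h2, abs_of_nonneg (densityAverage_nonneg _ _)]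
      calc β n / α n * |z| * densityAverage _ _ ≤ 2 * |z| * 1 :=
            mul_le_mul (by gcongr) (densityAverage_le_one _ _) (densityAverage_nonneg _ _)
              (by positivity)
        _ = _ := mul_one _
    · have hi : Integrable (fun z : ℝ => 2 * |z|) (gaussianReal 0 1) :=
        (((memLp_id_gaussianReal 1).integrable (by simp)).abs).const_mul 2
      exact hi.lintegral_lt_top.ne
    · refine ENNReal.tendsto_ofReal ?_
      refine (hβα.mul_const z).mul (tendsto_densityAverage hc ?_)
      have := (hmesh.mul hβα).mul_const z
      simpa using this
  have hlimval : ∫⁻ z, ENNReal.ofReal (1 * z * g) ∂gaussianReal 0 1 =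
      ENNReal.ofReal (1 / (2 * Real.pi) * Real.exp (-v ^ 2 / 2)) := by
    have hg0 : 0 ≤ g := gaussianPDFReal_nonneg _ _ _
    have : ∀ z : ℝ, ENNReal.ofReal (1 * z * g) = ENNReal.ofReal g * ENNReal.ofReal z := fun z => by
      rw [← ENNReal.ofReal_mul hg0]
      ring_nf
    simp_rw [this]
    rw [lintegral_const_mul _ (by fun_prop), lintegral_ofReal_gaussianReal,
      ← ENNReal.ofReal_mul hg0]
    congr 1
    have hpi : (√(2 * Real.pi))⁻¹ * (√(2 * Real.pi))⁻¹ = 1 / (2 * Real.pi) := by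
      rw [← mul_inv, Real.mul_self_sqrt (by positivity), one_div]
    rw [hg, gaussianPDFReal, ← hpi]
    simp only [NNReal.coe_one, mul_one, sub_zero]
    ring
  rw [hlimval] at hkey
  refine hkey.congr' ?_
  filter_upwards [hα.eventually_const_lt (show (0 : ℝ) < 1 by norm_num)] with n hn
  have hmeas : MeasurableSet {p : ℝ × ℝ | α n * p.1 - mesh n / 2 * (β n * p.2) ≤ v ∧
      v < α n * p.1 + mesh n / 2 * (β n * p.2)} :=
    (measurableSet_le (f := fun p : ℝ × ℝ => α n * p.1 - mesh n / 2 * (β n * p.2)) (by fun_prop)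
      measurable_const).inter (measurableSet_lt
        (g := fun p : ℝ × ℝ => α n * p.1 + mesh n / 2 * (β n * p.2)) measurable_const (by fun_prop))
  rw [stdNormal2, Measure.prod_apply_symm hmeas, ← lintegral_const_mul' _ _
    (by simpa using mesh_pos n)]
  refine lintegral_congr fun z => ?_
  -- For a fixed slope `z`, the midpoints that produce a step form an interval centred at `v / α n`.
  have hset : (fun x : ℝ => (x, z)) ⁻¹' {p : ℝ × ℝ | α n * p.1 - mesh n / 2 * (β n * p.2) ≤ v ∧
      v < α n * p.1 + mesh n / 2 * (β n * p.2)} =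
      Set.Ioc (v / α n - mesh n * (β n / α n) * z / 2) (v / α n + mesh n * (β n / α n) * z / 2) := by
    ext s
    simp only [Set.mem_preimage, Set.mem_ofPred_eq, Set.mem_Ioc]
    have e1 : v / α n - mesh n * (β n / α n) * z / 2 = (v - mesh n / 2 * (β n * z)) / α n := by
      field_simp
    have e2 : v / α n + mesh n * (β n / α n) * z / 2 = (v + mesh n / 2 * (β n * z)) / α n := by
      field_simp
    rw [e1, e2, div_lt_iff₀ hn, le_div_iff₀ hn]
    constructor
    · rintro ⟨h1, h2⟩; exact ⟨by linarith, by linarith⟩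
    · rintro ⟨h1, h2⟩; exact ⟨by linarith, by linarith⟩
  rw [hset, gaussianReal_Ioc, ← ENNReal.ofReal_inv_of_pos (mesh_pos n),
    ← ENNReal.ofReal_mul (inv_nonneg.2 (mesh_pos n).le)]
  congr 1
  have := (mesh_pos n).ne'
  field_simp

end Rice

/-! ### The law of a process on path space -/

/-- For bounded `f` the leftover integral from `⌊H⌋` to `H` is `O(1)`. Restricting to integer times
makes the convergence set visibly measurable, which is needed to transfer almost sure statements to
the image law. -/
lemma tendsto_average_of_nat {f : ℝ → ℝ} (hf : Measurable f) {C c : ℝ} (hC : ∀ s, |f s| ≤ C)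
    (h : Tendsto (fun n : ℕ => (n : ℝ)⁻¹ * ∫ s in (0 : ℝ)..n, f s) atTop (𝓝 c)) :
    Tendsto (fun H : ℝ => H⁻¹ * ∫ s in (0 : ℝ)..H, f s) atTop (𝓝 c) := by
  have hint : ∀ a b : ℝ, IntervalIntegrable f volume a b := fun a b =>
    (intervalIntegrable_const (c := C)).mono_fun hf.aestronglyMeasurable
      (ae_of_all _ fun s => (hC s).trans (le_abs_self C))
  have h1 := (tendsto_nat_floor_div_atTop (R := ℝ)).mul (h.comp tendsto_nat_floor_atTop)
  have h2 : Tendsto (fun H : ℝ => H⁻¹ * ∫ s in (⌊H⌋₊ : ℝ)..H, f s) atTop (𝓝 0) := by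
    have hC0 : 0 ≤ C := (abs_nonneg _).trans (hC 0)
    refine squeeze_zero_norm' (a := fun H : ℝ => H⁻¹ * C) ?_ ?_
    · filter_upwards [eventually_gt_atTop 0] with H hH
      rw [norm_mul, Real.norm_of_nonneg (inv_nonneg.2 hH.le)]
      refine mul_le_mul_of_nonneg_left ?_ (inv_nonneg.2 hH.le)
      refine (intervalIntegral.norm_integral_le_of_norm_le_const fun s _ => hC s).trans ?_
      have h1 := Nat.floor_le hH.le
      have h2 := Nat.lt_floor_add_one H
      rw [abs_of_nonneg (by linarith)]
      calc C * (H - ⌊H⌋₊) ≤ C * 1 := by gcongr; linarith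
        _ = C := mul_one C
    · simpa using tendsto_inv_atTop_zero.mul_const C
  have h3 := h1.add h2
  rw [one_mul, add_zero] at h3
  refine h3.congr' ?_
  filter_upwards [eventually_ge_atTop 1] with H hH
  have hfl : (0 : ℝ) < ⌊H⌋₊ := by
    exact_mod_cast (Nat.floor_pos.2 hH)
  simp only [Function.comp_apply]
  rw [← intervalIntegral.integral_add_adjacent_intervals (hint 0 ⌊H⌋₊) (hint ⌊H⌋₊ H)]
  field_simp

section Lift

variable {Ω : Type*} [MeasurableSpace Ω] {P : Measure Ω} {Y : ℝ≥0 → Ω → ℝ}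

/-- A process with almost surely differentiable paths has a version with values in the space of
differentiable paths. -/
lemma exists_diffPath_version (hY : ∀ t, Measurable (Y t)) (hdiff : HasDifferentiablePaths Y P) :
    ∃ path : Ω → DiffPath, Measurable path ∧ ∀ᵐ ω ∂P, (path ω).1 = fun t => Y t ω := by
  classical
  set N := toMeasurable P
    {ω | ¬ DifferentiableOn ℝ (fun s : ℝ => Y s.toNNReal ω) (Set.Ici 0)} with hN
  have hN0 : P N = 0 := by rw [hN, measure_toMeasurable]; exact hdiff
  have hNm : MeasurableSet N := measurableSet_toMeasurable _ _
  have hprop : ∀ ω, DifferentiableOn ℝ (fun s : ℝ => if ω ∈ N then 0 else Y s.toNNReal ω)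
      (Set.Ici 0) := by
    intro ω
    by_cases hω : ω ∈ N
    · simp [hω]
    · simp only [hω, if_false]
      by_contra hcon
      exact hω (subset_toMeasurable _ _ hcon)
  refine ⟨fun ω => ⟨fun t => if ω ∈ N then 0 else Y t ω, hprop ω⟩, ?_, ?_⟩
  · exact Measurable.subtype_mk (measurable_pi_iff.2 fun t =>
      Measurable.ite hNm measurable_const (hY t))
  · filter_upwards [measure_eq_zero_iff_ae_notMem.1 hN0] with ω hω
    simp [hω]

lemma DiffPath.measure_ext {μ₁ μ₂ : Measure DiffPath}
    (h : μ₁.map Subtype.val = μ₂.map Subtype.val) : μ₁ = μ₂ := by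
  ext A hA
  obtain ⟨B, hB, rfl⟩ := hA
  rw [← Measure.map_apply measurable_subtype_coe hB, ← Measure.map_apply measurable_subtype_coe hB,
    h]

variable {path : Ω → DiffPath}

lemma isErgodicLaw_map (hpath : Measurable path)
    (hver : ∀ᵐ ω ∂P, (path ω).1 = fun t => Y t ω) (hstat : IsStationary Y P)
    (herg : IsErgodic Y P) : IsErgodicLaw (P.map path) := by
  refine ⟨fun s => DiffPath.measure_ext ?_, fun g hg ⟨C, hC⟩ => ?_⟩
  · rw [Measure.map_map (measurable_shift s) hpath,
      Measure.map_map measurable_subtype_coe ((measurable_shift s).comp hpath),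
      Measure.map_map measurable_subtype_coe hpath]
    have h1 : (Subtype.val ∘ (shift s ∘ path)) =ᵐ[P] fun ω t => Y (t + s) ω := by
      filter_upwards [hver] with ω hω
      ext t
      simp [hω]
    have h2 : (Subtype.val ∘ path) =ᵐ[P] fun ω t => Y t ω := hver
    rw [Measure.map_congr h1, Measure.map_congr h2, hstat s]
  -- A measurable functional of differentiable paths is the restriction of one on all paths;
  -- truncating that extension at `±C` makes it bounded everywhere without changing `g`.
  · obtain ⟨G₀, hG₀, hgG₀⟩ := Measurable.exists_eq_measurable_comp (f := Subtype.val) hg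
    set G : (ℝ≥0 → ℝ) → ℝ := fun y => max (-C) (min C (G₀ y)) with hG
    have hGm : Measurable G := measurable_const.max (measurable_const.min hG₀)
    have hgG : ∀ y : DiffPath, g y = G y.1 := fun y => by
      have h1 := abs_le.1 (hC y)
      have h2 : G₀ y.1 = g y := by rw [hgG₀]; rfl
      simp only [hG, h2, min_eq_right h1.2, max_eq_right h1.1]
    have hGb : ∀ y, |G y| ≤ |C| := fun y => by
      rw [abs_le]
      refine ⟨(neg_le_neg (le_abs_self C)).trans (le_max_left _ _), max_le (neg_le_abs C) ?_⟩
      exact (min_le_left _ _).trans (le_abs_self C)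
    have hmeasF : ∀ n : ℕ, Measurable fun y : DiffPath =>
        (n : ℝ)⁻¹ * ∫ s in (0 : ℝ)..n, g (shift s.toNNReal y) := fun n => by
      simp_rw [intervalIntegral.integral_of_le (n.cast_nonneg : (0 : ℝ) ≤ n)]
      refine measurable_const.mul (StronglyMeasurable.measurable ?_)
      refine StronglyMeasurable.integral_prod_right'
        (f := fun p : DiffPath × ℝ => g (shift p.2.toNNReal p.1)) (Measurable.stronglyMeasurable ?_)
      fun_prop
    have hnat : ∀ᵐ y ∂P.map path, Tendsto (fun n : ℕ =>
        (n : ℝ)⁻¹ * ∫ s in (0 : ℝ)..n, g (shift s.toNNReal y)) atTop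
        (𝓝 (∫ y', g y' ∂P.map path)) := by
      rw [ae_map_iff hpath.aemeasurable (measurableSet_tendsto _ hmeasF)]
      have hlim : ∫ y', g y' ∂P.map path = ∫ ω, G (fun t => Y t ω) ∂P := by
        rw [integral_map hpath.aemeasurable hg.aestronglyMeasurable]
        refine integral_congr_ae ?_
        filter_upwards [hver] with ω hω
        rw [hgG, hω]
      rw [hlim]
      filter_upwards [hver, herg G hGm ⟨|C|, hGb⟩] with ω hω hω'
      refine (hω'.comp tendsto_natCast_atTop_atTop).congr fun n => ?_
      simp only [Function.comp_apply, hgG]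
      congr 2
      ext s
      congr 1
      ext t
      simp [hω]
    filter_upwards [hnat] with y hy
    exact tendsto_average_of_nat (by fun_prop) (fun s => hC _) hy

end Lift

/-! ### Path derivatives as functionals on path space -/

lemma DiffPath.tendsto_slope (y : DiffPath) (t : ℝ≥0) :
    Tendsto (fun n => (mesh n)⁻¹ * (y.1 ((mesh n).toNNReal + t) - y.1 t)) atTop
      (𝓝 (derivWithin y.extend (Set.Ici 0) t)) := by
  have hd : HasDerivWithinAt y.extend (derivWithin y.extend (Set.Ici 0) t) (Set.Ici 0) t :=
    (y.2 t t.coe_nonneg).hasDerivWithinAt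
  rw [hasDerivWithinAt_iff_tendsto_slope] at hd
  have hmesh : Tendsto mesh atTop (𝓝 0) := tendsto_mesh.mono_right nhdsWithin_le_nhds
  have hto : Tendsto (fun n => (t : ℝ) + mesh n) atTop (𝓝[Set.Ici 0 \ {(t : ℝ)}] t) := by
    refine tendsto_nhdsWithin_iff.2 ⟨by simpa using hmesh.const_add (t : ℝ),
      Eventually.of_forall fun n => ⟨?_, ?_⟩⟩
    · exact add_nonneg t.coe_nonneg (mesh_pos n).le
    · simpa using (mesh_pos n).ne'
  refine (hd.comp hto).congr fun n => ?_
  simp only [Function.comp_apply, slope_def_field, DiffPath.extend, add_sub_cancel_left,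
    Real.toNNReal_add t.coe_nonneg (mesh_pos n).le, Real.toNNReal_coe]
  rw [div_eq_inv_mul, add_comm t]

/-- The right derivative of a path at `0`, as a measurable functional. -/
def rightSlope (y : DiffPath) : ℝ :=
  limsup (fun n => (mesh n)⁻¹ * (y.1 (mesh n).toNNReal - y.1 0)) atTop

lemma measurable_rightSlope : Measurable rightSlope :=
  Measurable.limsup fun _ => measurable_const.mul ((measurable_apply _).sub (measurable_apply _))

/-- Shifting moves the derivative at time `t` to time `0`, so `f(Y_t, Y'_t)` is a fixed functional
evaluated along the shifts. -/
lemma rightSlope_shift (y : DiffPath) (t : ℝ≥0) :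
    rightSlope (shift t y) = derivWithin y.extend (Set.Ici 0) t := by
  refine Tendsto.limsup_eq ((y.tendsto_slope t).congr fun n => ?_)
  simp

/-- The reciprocal of the speed of the time change, as a functional of the path. -/
def invSpeed (f : ℝ × ℝ → ℝ) (y : DiffPath) : ℝ≥0∞ := ENNReal.ofReal (1 / f (y.1 0, rightSlope y))

lemma measurable_invSpeed {f : ℝ × ℝ → ℝ} (hf : Measurable f) : Measurable (invSpeed f) := by
  have : Measurable fun y : DiffPath => (y.1 0, rightSlope y) :=
    (measurable_apply 0).prodMk measurable_rightSlope
  unfold invSpeed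
  fun_prop

lemma q₀_pos {f : ℝ × ℝ → ℝ} (hf : ∀ p, 0 < f p)
    (hq : Integrable (fun p => 1 / f p) stdNormal2) : 0 < q₀ f := by
  have hpos : ∀ p, 0 < 1 / f p := fun p => one_div_pos.2 (hf p)
  refine (integral_pos_iff_support_of_nonneg (fun p => (hpos p).le) hq).2 ?_
  have : Function.support (fun p => 1 / f p) = Set.univ :=
    Set.eq_univ_of_forall fun p => (hpos p).ne'
  rw [this]
  simp

/-- Along a path, the time change has measurable positive speed. -/
lemma measurable_speed (y : DiffPath) {f : ℝ × ℝ → ℝ} (hf : Measurable f) :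
    Measurable fun s : ℝ≥0 => f (y.1 s, derivWithin y.extend (Set.Ici 0) s) := by
  have h1 : Measurable fun s : ℝ≥0 => rightSlope (shift s y) :=
    measurable_rightSlope.comp (by fun_prop)
  simp_rw [rightSlope_shift] at h1
  have h2 := y.continuous.measurable
  fun_prop

lemma occupation_invSpeed (f : ℝ × ℝ → ℝ) (y : DiffPath) (H : ℝ) :
    occupation (invSpeed f) H y = ∫⁻ s in Set.Ioc 0 H, ENNReal.ofReal
      (1 / f (y.1 s.toNNReal, derivWithin y.extend (Set.Ici 0) (s.toNNReal : ℝ))) := by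
  simp [occupation, invSpeed, rightSlope_shift]

/-! ### Gaussian processes with differentiable paths -/

section GaussianProcess

variable {Ω : Type*} [MeasurableSpace Ω] {P : Measure Ω} {Y : ℝ≥0 → Ω → ℝ}

/-- The midpoint and the slope of the process over `[0, mesh n]`. -/
def midpointSlope (Y : ℝ≥0 → Ω → ℝ) (n : ℕ) (ω : Ω) : ℝ × ℝ :=
  (2⁻¹ * (Y 0 ω + Y (mesh n).toNNReal ω), (mesh n)⁻¹ * (Y (mesh n).toNNReal ω - Y 0 ω))

lemma tendsto_midpointSlope (hdiff : HasDifferentiablePaths Y P) :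
    ∀ᵐ ω ∂P, Tendsto (fun n => midpointSlope Y n ω) atTop (𝓝 (Y 0 ω, pathDeriv Y 0 ω)) := by
  filter_upwards [hdiff] with ω hω
  set y : DiffPath := ⟨fun t => Y t ω, hω⟩
  refine Tendsto.prodMk_nhds ?_ ?_
  · have hmesh : Tendsto mesh atTop (𝓝 0) := tendsto_mesh.mono_right nhdsWithin_le_nhds
    have h1 : Tendsto (fun n => Y (mesh n).toNNReal ω) atTop (𝓝 (Y 0 ω)) := by
      have := (y.continuous_extend.tendsto 0).comp hmesh
      rwa [show y.extend 0 = Y 0 ω by simp [DiffPath.extend, y]] at this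
    have h2 := (h1.const_add (Y 0 ω)).const_mul 2⁻¹
    convert h2 using 2
    ring
  · have := y.tendsto_slope 0
    simp only [add_zero] at this
    exact this

/-- The law of `(Y₀, Y'₀)` and the variances of midpoints and slopes. -/
lemma exists_midpointSlope_law [IsProbabilityMeasure P] (hY : IsGaussianProcess Y P)
    (hdiff : HasDifferentiablePaths Y P)
    (hmean : ∀ t, ∫ ω, Y t ω ∂P = 0) (hvar : ∀ t, variance (Y t) P = 1)
    (hdvar : variance (pathDeriv Y 0) P = 1) :
    ∃ α β : ℕ → ℝ, Tendsto α atTop (𝓝 1) ∧ Tendsto β atTop (𝓝 1) ∧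
      ∀ n, P.map (midpointSlope Y n) = stdNormal2.map (fun p => (α n * p.1, β n * p.2)) := by
  have hUV : ∀ n, HasGaussianLaw (fun ω => (Y 0 ω, Y (mesh n).toNNReal ω)) P := fun n =>
    hY.hasGaussianLaw_prodMk
  have hint : ∀ t, Integrable (Y t) P := fun t => (hY.hasGaussianLaw_eval t).integrable
  have hlim := tendsto_midpointSlope hdiff
  refine ⟨fun n => √(variance (fun ω => 2⁻¹ * (Y 0 ω + Y (mesh n).toNNReal ω)) P),
    fun n => √(variance (fun ω => (mesh n)⁻¹ * (Y (mesh n).toNNReal ω - Y 0 ω)) P), ?_, ?_,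
    fun n => map_midpoint_slope (hUV n) (hmean 0) (hmean _) (by rw [hvar, hvar]) (mesh n)⟩
  · have h := tendsto_variance_of_ae_tendsto (P := P)
      (X := fun n ω => 2⁻¹ * (Y 0 ω + Y (mesh n).toNNReal ω)) (L := Y 0)
      (fun n => (hUV n).fun_add.fun_smul 2⁻¹)
      (fun n => by rw [integral_const_mul, integral_add (hint _) (hint _), hmean, hmean]; simp)
      (by
        filter_upwards [hlim] with ω hω
        exact (continuous_fst.tendsto _).comp hω)
    rw [hvar] at h
    simpa using h.sqrt
  · have h := tendsto_variance_of_ae_tendsto (P := P)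
      (X := fun n ω => (mesh n)⁻¹ * (Y (mesh n).toNNReal ω - Y 0 ω)) (L := pathDeriv Y 0)
      (fun n => (hY.hasGaussianLaw_fun_sub (s := (mesh n).toNNReal) (t := 0)).fun_smul (mesh n)⁻¹)
      (fun n => by rw [integral_const_mul, integral_sub (hint _) (hint _), hmean, hmean]; simp)
      (by
        filter_upwards [hlim] with ω hω
        exact (continuous_snd.tendsto _).comp hω)
    rw [hdvar] at h
    simpa using h.sqrt

lemma measurable_midpointSlope (hYm : ∀ t, Measurable (Y t)) (n : ℕ) :
    Measurable (midpointSlope Y n) := by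
  unfold midpointSlope
  fun_prop

/-- The rate of steps of a stationary Gaussian process over a level. -/
lemma tendsto_step_probability (hYm : ∀ t, Measurable (Y t)) {α β : ℕ → ℝ}
    (hα : Tendsto α atTop (𝓝 1)) (hβ : Tendsto β atTop (𝓝 1))
    (hlaw : ∀ n, P.map (midpointSlope Y n) = stdNormal2.map (fun p => (α n * p.1, β n * p.2)))
    (v : ℝ) :
    Tendsto (fun n => (ENNReal.ofReal (mesh n))⁻¹ *
      P {ω | Y 0 ω ≤ v ∧ v < Y (mesh n).toNNReal ω}) atTop
      (𝓝 (ENNReal.ofReal (1 / (2 * Real.pi) * Real.exp (-v ^ 2 / 2)))) := by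
  refine (tendsto_stdNormal2_step hα hβ v).congr fun n => ?_
  congr 1
  -- The step event in midpoint and slope coordinates: the endpoint values are the midpoint minus
  -- and plus half the step length times the slope.
  set A : Set (ℝ × ℝ) := {p | p.1 - mesh n / 2 * p.2 ≤ v ∧ v < p.1 + mesh n / 2 * p.2} with hA
  have hAm : MeasurableSet A :=
    (measurableSet_le (f := fun p : ℝ × ℝ => p.1 - mesh n / 2 * p.2) (by fun_prop)
      measurable_const).inter (measurableSet_lt
        (g := fun p : ℝ × ℝ => p.1 + mesh n / 2 * p.2) measurable_const (by fun_prop))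
  have h1 := congrArg (fun m => m A) (hlaw n)
  simp only [Measure.map_apply (measurable_midpointSlope hYm n) hAm,
    Measure.map_apply (show Measurable fun p : ℝ × ℝ => (α n * p.1, β n * p.2) by fun_prop) hAm]
    at h1
  refine h1.symm.trans ?_
  congr 1
  ext ω
  have hm := (mesh_pos n).ne'
  have e1 : 2⁻¹ * (Y 0 ω + Y (mesh n).toNNReal ω) -
      mesh n / 2 * ((mesh n)⁻¹ * (Y (mesh n).toNNReal ω - Y 0 ω)) = Y 0 ω := by
    field_simp; ring
  have e2 : 2⁻¹ * (Y 0 ω + Y (mesh n).toNNReal ω) +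
      mesh n / 2 * ((mesh n)⁻¹ * (Y (mesh n).toNNReal ω - Y 0 ω)) = Y (mesh n).toNNReal ω := by
    field_simp; ring
  simp only [hA, midpointSlope, Set.mem_preimage, Set.mem_ofPred_eq, e1, e2]

lemma measure_level_eq_zero (hY : IsGaussianProcess Y P)
    (hvar : ∀ t, variance (Y t) P = 1) (t : ℝ≥0) (v : ℝ) : P {ω | Y t ω = v} = 0 := by
  have hG := hY.hasGaussianLaw_eval t
  have h := hG.map_eq_gaussianReal
  rw [hvar, Real.toNNReal_one] at h
  have : NullSingletonClass (gaussianReal (∫ ω, Y t ω ∂P) 1) :=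
    nullSingletonClass_gaussianReal one_ne_zero
  have h0 : P.map (Y t) {v} = 0 := by rw [h]; exact measure_singleton v
  rwa [Measure.map_apply_of_aemeasurable hG.aemeasurable (measurableSet_singleton v)] at h0

end GaussianProcess

/-- An up-crossing is defined by order comparisons with the level alone, and these are preserved and
reflected by `h`; no continuity of `h` or of `x` is involved. -/
lemma upcrossings_eq_of_strictMonoOn {D : Set ℝ} {h : ℝ → ℝ} (hh : StrictMonoOn h D)
    {x z : ℝ≥0 → ℝ} (hx : ∀ t, x t ∈ D ∧ h (x t) = z t) {u : ℝ} (hu : u ∈ D) (T : ℝ≥0) :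
    upcrossings x u T = upcrossings z (h u) T := by
  have h1 : ∀ t, x t ≤ u ↔ z t ≤ h u := fun t => by
    rw [← (hx t).2, hh.le_iff_le (hx t).1 hu]
  have h2 : ∀ t, u ≤ x t ↔ h u ≤ z t := fun t => by
    rw [← (hx t).2, hh.le_iff_le hu (hx t).1]
  have h3 : ∀ t, x t = u ↔ z t = h u := fun t => by
    rw [le_antisymm_iff, le_antisymm_iff, h1, h2]
  ext t
  simp only [upcrossings, IsUpcrossing, Set.mem_ofPred_eq, h1, h2, h3]

/-! ### Crossing rate and mean reciprocal speed for the Gaussian process. -/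

section Rates

variable {Ω : Type*} [MeasurableSpace Ω] {P : Measure Ω} [IsProbabilityMeasure P]
  {Y : ℝ≥0 → Ω → ℝ}

/-- Rice's formula, together with the ergodic average of the reciprocal speed of a time change. -/
theorem ae_hasUpcrossingIntensity_and_average (hYmeas : ∀ t, Measurable (Y t))
    (hYgauss : IsGaussianProcess Y P) (hYdiff : HasDifferentiablePaths Y P)
    (hYstat : IsStationary Y P) (hYerg : IsErgodic Y P) (hYmean : ∀ t, ∫ ω, Y t ω ∂P = 0)
    (hYvar : ∀ t, variance (Y t) P = 1) (hYdvar : ∀ t, variance (pathDeriv Y t) P = 1)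
    {f : ℝ × ℝ → ℝ} (hfmeas : Measurable f) (hfpos : ∀ p, 0 < f p)
    (hq₀ : Integrable (fun p => 1 / f p) stdNormal2) (v : ℝ) :
    ∀ᵐ ω ∂P, HasUpcrossingIntensity (fun t => Y t ω) v
        (1 / (2 * Real.pi) * Real.exp (-v ^ 2 / 2)) ∧
      Measurable (fun s => f (Y s ω, pathDeriv Y s ω)) ∧
      (∀ H : ℝ, ∫⁻ s in Set.Ioc 0 H,
        ENNReal.ofReal (1 / f (Y s.toNNReal ω, pathDeriv Y s.toNNReal ω)) < ∞) ∧
      Tendsto (fun H : ℝ => (ENNReal.ofReal H)⁻¹ * ∫⁻ s in Set.Ioc 0 H,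
        ENNReal.ofReal (1 / f (Y s.toNNReal ω, pathDeriv Y s.toNNReal ω))) atTop
        (𝓝 (ENNReal.ofReal (q₀ f))) := by
  obtain ⟨path, hpath, hver⟩ := exists_diffPath_version hYmeas hYdiff
  set μ := P.map path with hμdef
  have : IsProbabilityMeasure μ := Measure.isProbabilityMeasure_map hpath.aemeasurable
  have hμ : IsErgodicLaw μ := isErgodicLaw_map hpath hver hYstat hYerg
  obtain ⟨α, β, hα, hβ, hlaw⟩ := exists_midpointSlope_law hYgauss hYdiff hYmean hYvar (hYdvar 0)
  have hlevel : ∀ t, μ {y : DiffPath | y.1 t = v} = 0 := fun t => by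
    rw [hμdef, Measure.map_apply hpath
      (measurableSet_eq_fun (measurable_apply t) measurable_const),
      ← measure_level_eq_zero hYgauss hYvar t v]
    refine measure_congr (eventuallyEq_set.2 ?_)
    filter_upwards [hver] with ω hω
    simp [hω]
  have hstep : Tendsto (fun n => (ENNReal.ofReal (mesh n))⁻¹ *
      μ {y : DiffPath | y.1 0 ≤ v ∧ v < y.1 (mesh n).toNNReal}) atTop
      (𝓝 (ENNReal.ofReal (1 / (2 * Real.pi) * Real.exp (-v ^ 2 / 2)))) := by
    refine (tendsto_step_probability hYmeas hα hβ hlaw v).congr fun n => ?_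
    rw [hμdef, Measure.map_apply hpath (measurableSet_step v _)]
    congr 1
    refine measure_congr (eventuallyEq_set.2 ?_)
    filter_upwards [hver] with ω hω
    simp [hω]
  have hderiv : ∀ᵐ ω ∂P, ∀ t : ℝ≥0,
      derivWithin (path ω).extend (Set.Ici 0) t = pathDeriv Y t ω := by
    filter_upwards [hver] with ω hω t
    have : (path ω).extend = fun s : ℝ => Y s.toNNReal ω := by
      ext s
      simp [DiffPath.extend, hω]
    rw [this]
    rfl
  have hjoint : P.map (fun ω => (Y 0 ω, pathDeriv Y 0 ω)) = stdNormal2 :=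
    map_eq_stdNormal2_of_tendsto (fun n => (measurable_midpointSlope hYmeas n).aemeasurable)
      (tendsto_midpointSlope hYdiff) hα hβ hlaw
  -- `invSpeed` reads only the value and slope at time `0`, whose joint law is `stdNormal2`.
  have hspeed : ∫⁻ y, invSpeed f y ∂μ = ENNReal.ofReal (q₀ f) := by
    have hm : Measurable fun p => ENNReal.ofReal (1 / f p) := by fun_prop
    have hpair : AEMeasurable (fun ω => (Y 0 ω, pathDeriv Y 0 ω)) P :=
      aemeasurable_of_tendsto_metrizable_ae'
        (fun n => (measurable_midpointSlope hYmeas n).aemeasurable) (tendsto_midpointSlope hYdiff)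
    rw [q₀, ofReal_integral_eq_lintegral_ofReal hq₀
      (ae_of_all _ fun p => (one_div_pos.2 (hfpos p)).le), ← hjoint,
      lintegral_map' hm.aemeasurable hpair, hμdef, lintegral_map (measurable_invSpeed hfmeas) hpath]
    refine lintegral_congr_ae ?_
    filter_upwards [hver, hderiv] with ω hω hω'
    have h0 := rightSlope_shift (path ω) 0
    rw [shift_zero, hω' 0] at h0
    simp [invSpeed, h0, hω]
  have hfin : ∫⁻ y, invSpeed f y ∂μ ≠ ∞ := by rw [hspeed]; simp
  have h1 := ae_of_ae_map hpath.aemeasurable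
    (hμ.hasUpcrossingIntensity (by positivity) hlevel hstep)
  have h2 := ae_of_ae_map hpath.aemeasurable
    (hμ.occupation_lt_top (measurable_invSpeed hfmeas) hfin)
  have h3 := ae_of_ae_map hpath.aemeasurable
    (hμ.tendsto_occupation (measurable_invSpeed hfmeas) hfin)
  rw [hspeed] at h3
  filter_upwards [h1, h2, h3, hver, hderiv] with ω h1 h2 h3 hω hω'
  have h4 := measurable_speed (path ω) hfmeas
  simp only [occupation_invSpeed, hω', hω] at h1 h2 h3 h4
  exact ⟨h1, h4, h2, h3⟩

end Rates

end TimeChange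

end

theorem mainTheorem5 {Ω : Type*} [MeasurableSpace Ω] (P : Measure Ω) [IsProbabilityMeasure P]
    -- the base process: a differentiable ergodic stationary Gaussian process
    (Y : ℝ≥0 → Ω → ℝ) (hYmeas : ∀ t, Measurable (Y t))
    (hYgauss : IsGaussianProcess Y P)
    (hYdiff : TimeChange.HasDifferentiablePaths Y P)
    (hYstat : TimeChange.IsStationary Y P)
    (hYerg : TimeChange.IsErgodic Y P)
    (hYmean : ∀ t, ∫ ω, Y t ω ∂P = 0)
    (hYvar : ∀ t, variance (Y t) P = 1)
    (hYdvar : ∀ t, variance (TimeChange.pathDeriv Y t) P = 1)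
    -- the time change
    (f : ℝ × ℝ → ℝ) (hfmeas : Measurable f) (hfpos : ∀ p, 0 < f p)
    (hq₀ : Integrable (fun p => 1 / f p) TimeChange.stdNormal2)
    (φ : ℝ≥0 → Ω → ℝ≥0) (hφ : TimeChange.IsTimeChange f Y φ P)
    (Z : ℝ≥0 → Ω → ℝ) (hZ : ∀ᵐ ω ∂P, ∀ t, Z t ω = Y (φ t ω) ω)
    -- the marginal link function, defined and increasing on a set `D` of possible values of `X`
    (D : Set ℝ) (h : ℝ → ℝ) (hh : StrictMonoOn h D)
    (X : ℝ≥0 → Ω → ℝ) (hX : ∀ᵐ ω ∂P, ∀ t, X t ω ∈ D ∧ h (X t ω) = Z t ω)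
    (u : ℝ) (hu : u ∈ D) :
    ∃ νX νZ νY : ℝ,
      (∀ᵐ ω ∂P, TimeChange.HasUpcrossingIntensity (fun t => X t ω) u νX) ∧
      (∀ᵐ ω ∂P, TimeChange.HasUpcrossingIntensity (fun t => Z t ω) (h u) νZ) ∧
      (∀ᵐ ω ∂P, TimeChange.HasUpcrossingIntensity (fun t => Y t ω) (h u) νY) ∧
      νX = νZ ∧
      νZ = 1 / TimeChange.q₀ f * νY ∧
      1 / TimeChange.q₀ f * νY =
        1 / (2 * Real.pi * TimeChange.q₀ f) * Real.exp (-(h u) ^ 2 / 2) := by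
  have hmain := TimeChange.ae_hasUpcrossingIntensity_and_average hYmeas hYgauss hYdiff hYstat hYerg
    hYmean hYvar hYdvar hfmeas hfpos hq₀ (h u)
  have hq := TimeChange.q₀_pos hfpos hq₀
  set νY := 1 / (2 * Real.pi) * Real.exp (-(h u) ^ 2 / 2) with hνY
  have hZint : ∀ᵐ ω ∂P, TimeChange.HasUpcrossingIntensity (fun t => Z t ω) (h u)
      (1 / TimeChange.q₀ f * νY) := by
    filter_upwards [hmain, hφ, hZ] with ω ⟨h1, h2, h3, h4⟩ hφω hZω
    -- From here the argument is deterministic for each path, with speed `k = f(Y, Y')`.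
    have := h1.comp_timeChange
      (k := fun s => f (Y s ω, TimeChange.pathDeriv Y s ω)) (φ := fun t => φ t ω)
      (fun t => hφω t) (fun s => hfpos _) h2 hq h3 h4
    simpa only [hZω] using this
  refine ⟨1 / TimeChange.q₀ f * νY, 1 / TimeChange.q₀ f * νY, νY, ?_, hZint,
    hmain.mono fun ω hω => hω.1, rfl, rfl, ?_⟩
  · filter_upwards [hZint, hX] with ω hω hXω
    simpa only [TimeChange.HasUpcrossingIntensity,
      TimeChange.upcrossings_eq_of_strictMonoOn hh hXω hu] using hω
  · rw [hνY]
    field_simp
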